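/- All graphs are finite undirected multigraphs. Write $c(H)$ for the number of components of a graph $H$. A graph $G$ is $t$-tough if $|S|\ge t\cdot c(G-S)$ for every $S\subseteq V(G)$ with $c(G-S)>1$; its toughness $\tau(G)$ is the largest $t$ for which $G$ is $t$-tough (and $\infty$ if no vertex set disconnects $G$). $G$ is minimally $t$-tough if $\tau(G)=t$ and $\tau(G-e)<t$ for every edge $e$ of $G$. A series-parallel graph (sp-graph) $G(s,t)$ with terminals $s,t$ is either a single edge joining the distinct vertices $s$ and $t$, or arises from $k\ge 2$ sp-graphs $G_1(s_1,t_1),\dots,G_k(s_k,t_k)$ by a series join (identify $t_i$ with $s_{i+1}$ for $1\le i<k$, and put $s=s_1$, $t=t_k$) or by a parallel join (identify all $s_i$ to $s$ and all $t_i$ to $t$). Its sp-tree is the rooted tree recording such a construction, with leaves for the edges and a series or parallel node for every join, the joins being chosen so that no child of a series node is a series node and no child of a parallel node is a parallel node; it is unique up to the order of the children of parallel nodes. The height of a tree is the number of edges on a longest path from the root to a leaf. A graph is reduced if it contains no induced path of length at least $3$ all of whose inner vertices have degree $2$ in the graph. $P_3$ is the path with three vertices, and $R_2$ is the parallel join of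 two copies of the path with two edges (whose terminals are its ends). A necklace graph is a series join of at least two graphs, each of which is a single edge or a copy of $R_2$, where the first and the last of them are single edges. Lemma. Let $G=G(s,t)$ be an sp-graph that is reduced and minimally $\tfrac12$-tough. Then $G(s,t)$ has an sp-tree, and its height is $1$ or $3$. If the height is $1$, then $G=P_3$; otherwise $G$ (with terminals $s,t$) is a necklace graph different from $P_3$. -/

import Mathlib

open scoped Graph

/-! ### Toughness of multigraphs -/

namespace Graph

/-- The number `c(G)` of connected components of a (finite) multigraph. -/
noncomputable def numComponents {α : Type*} {β : Type*} (G : Graph α β) : ℕ :=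
  Nat.card (SimpleGraph.fromRel (fun x y : V(G) => G.Adj (x : α) (y : α))).ConnectedComponent

/-- `G` is `t`-tough: `|S| ≥ t * c(G - S)` for every vertex set `S` with `c(G - S) > 1`. -/
def IsTough {α : Type*} {β : Type*} (G : Graph α β) (t : ℝ) : Prop :=
  ∀ S : Finset α, (S : Set α) ⊆ V(G) → 1 < (G.deleteVerts (S : Set α)).numComponents →
    t * ((G.deleteVerts (S : Set α)).numComponents : ℝ) ≤ (S.card : ℝ)

/-- The toughness `τ(G)`: the largest `t` for which `G` is `t`-tough. It is `⊤` exactly when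
no vertex set disconnects `G`, as for complete graphs. -/
noncomputable def toughness {α : Type*} {β : Type*} (G : Graph α β) : EReal :=
  ⨆ (t : ℝ) (_ : G.IsTough t), (t : EReal)

/-- `G` is minimally `t`-tough: `τ(G) = t`, and `τ(G - e) < t` for every edge `e`. -/
def IsMinimallyTough {α : Type*} {β : Type*} (G : Graph α β) (t : ℝ) : Prop :=
  G.toughness = (t : EReal) ∧ ∀ e ∈ E(G), (G.deleteEdges {e}).toughness < (t : EReal)

/-- `p 0, p 1, …, p n` is an induced path of `G` of length `n`, and every inner vertex of the
path is incident with exactly two edges of `G`. -/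
structure IsInducedThread {α : Type*} {β : Type*} (G : Graph α β) (n : ℕ)
    (p : Fin (n + 1) → α) : Prop where
  mem : ∀ i, p i ∈ V(G)
  injective : Function.Injective p
  adj_iff : ∀ i j, G.Adj (p i) (p j) ↔ (i.val + 1 = j.val ∨ j.val + 1 = i.val)
  inner_degree : ∀ i, 0 < i.val → i.val < n → {e : β | G.Inc e (p i)}.encard = 2

/-- `G` is reduced: it has no path of length at least `3` that could be replaced by a path of
length `2`. -/
def IsReduced {α : Type*} {β : Type*} (G : Graph α β) : Prop :=
  ¬ ∃ (n : ℕ) (p : Fin (n + 1) → α), 3 ≤ n ∧ G.IsInducedThread n p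

/-- `G` is the path `P₃` on three vertices (with two edges). -/
def IsP3 {α : Type*} {β : Type*} (G : Graph α β) : Prop :=
  ∃ (a b c : α) (e f : β), a ≠ b ∧ b ≠ c ∧ a ≠ c ∧ e ≠ f ∧ V(G) = {a, b, c} ∧
    ∀ (g : β) (x y : α),
      G.IsLink g x y ↔ (g = e ∧ s(x, y) = s(a, b)) ∨ (g = f ∧ s(x, y) = s(b, c))

/-! ### Series and parallel joins -/

/-- `G` is the union of the pairwise edge-disjoint graphs `H i`. -/
structure IsEdgeDisjointUnion {α : Type*} {β : Type*} {k : ℕ} (H : Fin k → Graph α β)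
    (G : Graph α β) : Prop where
  disjoint : ∀ i j, i ≠ j → Disjoint E(H i) E(H j)
  vertexSet_eq : V(G) = ⋃ i, V(H i)
  isLink_iff : ∀ (e : β) (x y : α), G.IsLink e x y ↔ ∃ i, (H i).IsLink e x y

/-- `G` is the series join of `H 0, …, H (k - 1)`, where `H i` has terminals `x i` and
`x (i + 1)`: consecutive graphs share exactly the joining vertex, other pairs share nothing. -/
structure IsSeriesJoin {α : Type*} {β : Type*} {k : ℕ} (H : Fin k → Graph α β)
    (x : Fin (k + 1) → α) (G : Graph α β) : Prop where
  union : IsEdgeDisjointUnion H G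
  inter : ∀ i j : Fin k, i < j → ∀ v, v ∈ V(H i) → v ∈ V(H j) →
    i.val + 1 = j.val ∧ v = x j.castSucc

/-- `G` is the parallel join of `H 0, …, H (k - 1)`, all of which have terminals `s` and `t`:
any two of the graphs share exactly the two terminals. -/
structure IsParallelJoin {α : Type*} {β : Type*} {k : ℕ} (H : Fin k → Graph α β)
    (s t : α) (G : Graph α β) : Prop where
  union : IsEdgeDisjointUnion H G
  inter : ∀ i j : Fin k, i ≠ j → V(H i) ∩ V(H j) = {s, t}

end Graph

/-! ### Series-parallel trees -/

/-- Rooted ordered trees whose leaves stand for edges and whose other nodes are series nodes or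
parallel nodes. -/
inductive SPTree : Type
  | leaf : SPTree
  | series (k : ℕ) (c : Fin k → SPTree) : SPTree
  | parallel (k : ℕ) (c : Fin k → SPTree) : SPTree

namespace SPTree

/-- The number of edges on a longest path from the root to a leaf. -/
def height : SPTree → ℕ
  | leaf => 0
  | series _ c => (Finset.univ.sup fun i => (c i).height) + 1
  | parallel _ c => (Finset.univ.sup fun i => (c i).height) + 1

/-- The root is a series node. -/
def IsSeries : SPTree → Prop
  | leaf => False
  | series _ _ => True
  | parallel _ _ => False

/-- The root is a parallel node. -/
def IsParallel : SPTree → Prop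
  | leaf => False
  | series _ _ => False
  | parallel _ _ => True

/-- No child of a series node is a series node, no child of a parallel node is a parallel node. -/
def IsAlternating : SPTree → Prop
  | leaf => True
  | series _ c => ∀ i, ¬ (c i).IsSeries ∧ (c i).IsAlternating
  | parallel _ c => ∀ i, ¬ (c i).IsParallel ∧ (c i).IsAlternating

/-- `T.Realizes G s t`: the graph `G` with terminals `s` and `t` is obtained from single edges by
the series and parallel joins (of at least two graphs each) that are prescribed by `T`. -/
inductive Realizes {α : Type*} {β : Type*} : SPTree → Graph α β → α → α → Prop
  | leaf (e : β) (s t : α) (hst : s ≠ t) : Realizes SPTree.leaf (Graph.banana s t {e}) s t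
  | series (k : ℕ) (hk : 2 ≤ k) (c : Fin k → SPTree) (H : Fin k → Graph α β)
      (x : Fin (k + 1) → α) (G : Graph α β)
      (hc : ∀ i, Realizes (c i) (H i) (x i.castSucc) (x i.succ))
      (hG : Graph.IsSeriesJoin H x G) :
      Realizes (SPTree.series k c) G (x 0) (x (Fin.last k))
  | parallel (k : ℕ) (hk : 2 ≤ k) (c : Fin k → SPTree) (H : Fin k → Graph α β)
      (s t : α) (G : Graph α β)
      (hc : ∀ i, Realizes (c i) (H i) s t)
      (hG : Graph.IsParallelJoin H s t G) :
      Realizes (SPTree.parallel k c) G s t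

/-- A series node with two leaves: a path with two edges. -/
def twoPath : SPTree := series 2 fun _ => leaf

/-- `R₂`: the parallel join of two paths with two edges each. -/
def R2 : SPTree := parallel 2 fun _ => twoPath

/-- A series node with at least two children, each of which is a leaf or `R₂`, such that the
first and the last child are leaves. -/
def IsNecklace : SPTree → Prop
  | leaf => False
  | series k c => 2 ≤ k ∧ (∀ i, c i = leaf ∨ c i = R2) ∧
      (∀ i, i.val = 0 ∨ i.val + 1 = k → c i = leaf)
  | parallel _ _ => False

end SPTree

namespace Graph

/-- `G` is a series-parallel graph with terminals `s` and `t`. -/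
def IsSPGraph {α : Type*} {β : Type*} (G : Graph α β) (s t : α) : Prop :=
  ∃ T : SPTree, T.Realizes G s t

/-- `T` is the sp-tree of the series-parallel graph `G` with terminals `s` and `t`
(unique up to the order of the children of the parallel nodes). -/
def IsSPTreeOf {α : Type*} {β : Type*} (T : SPTree) (G : Graph α β) (s t : α) : Prop :=
  T.Realizes G s t ∧ T.IsAlternating

/-- `G` is a necklace graph with terminals `s` and `t`. -/
def IsNecklaceGraph {α : Type*} {β : Type*} (G : Graph α β) (s t : α) : Prop :=
  ∃ T : SPTree, T.IsNecklace ∧ T.Realizes G s t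

end Graph

/-! For a part `P` of the graph put `bal P S = c(P - S) - 2|S ∩ V(P)|`. Connectedness and
1/2-toughness together say that the balance of the whole graph is at most 1, and at most 0 as soon
as `S` meets the graph; a critical edge yields a set violating this after its deletion. Gluing two
parts at one or two vertices changes `bal` by a constant that depends only on which of these
vertices lie in `S` and on whether the parts still link them. Hence a part with terminals `u`, `v`
acts on the rest of the graph through a few maxima of `bal`. The only one that varies is the maximum
over sets containing both terminals, written `k - 4`: a path with at least two edges has `k = 1`,
and `k` is additive in parallel joins.

Two arguments bound `k`. In a parallel join, criticality of an edge that is a bridge of one side at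
`u` gives a tight set containing `v` but not `u` (`TwoSum.exists_tight_of_cutEdge`). This excludes a
single edge as a parallel branch and forces `k ≤ 3` (`TwoSum.le_three`). In a series join such a
tight set extends across the neighbouring part, which excludes a path next to a non-path
(`OneSum.half_of_ser`) and a part with `k = 3` next to a non-path (`OneSum.le_two_of_ser`).

By induction (`Builds.summary`), every part whose environment connects its terminals is a path (`k =
1`), a series join of pairs of parallel paths (`k = 2`), or a path parallel to such a chain (`k =
3`). Along a series root the environment of a part consists of two disjoint pieces. There `k ≤ 2`,
and both pieces are larger than a single vertex (`Builds.isBeads`), so each child of the root is an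
edge or, away from the two ends, a pair of parallel paths. Reducedness shortens these paths to
length two. Components are counted as the dimension of the space of locally constant functions,
which turns gluing into linear algebra. -/

namespace Graph

/-! ### Locally constant functions -/

/-- Functions that are supported on `V` and constant along the edges in `F` with ends in `V`. -/
def locConst {α β : Type*} (I : Graph α β) (V : Set α) (F : Set β) : Submodule ℚ (α → ℚ) where
  carrier := {f | (∀ x, x ∉ V → f x = 0) ∧
    ∀ e ∈ F, ∀ x y, I.IsLink e x y → x ∈ V → y ∈ V → f x = f y}
  add_mem' := by
    rintro f g ⟨hf, hf'⟩ ⟨hg, hg'⟩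
    refine ⟨fun x hx => by simp [hf x hx, hg x hx], fun e he x y h hx hy => ?_⟩
    simp [hf' e he x y h hx hy, hg' e he x y h hx hy]
  zero_mem' := by simp
  smul_mem' := by
    rintro c f ⟨hf, hf'⟩
    refine ⟨fun x hx => by simp [hf x hx], fun e he x y h hx hy => ?_⟩
    simp [hf' e he x y h hx hy]

variable {α β : Type*} {I : Graph α β}

theorem finiteDimensional_locConst {V : Set α} (hV : V.Finite) (F : Set β) :
    FiniteDimensional ℚ (I.locConst V F) := by
  have := hV.fintype
  let φ : I.locConst V F →ₗ[ℚ] (V → ℚ) :=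
    (LinearMap.funLeft ℚ ℚ (Subtype.val : V → α)).comp (I.locConst V F).subtype
  refine FiniteDimensional.of_injective φ ?_
  rintro ⟨f, hf, hf'⟩ ⟨g, hg, hg'⟩ h
  ext x
  by_cases hx : x ∈ V
  · exact congrFun h ⟨x, hx⟩
  · simp [hf x hx, hg x hx]

/-- Rank-nullity for one functional. It serves to count the components lost when two parts are
identified at a vertex. -/
theorem finrank_inf_ker_of_ne {M : Type*} [AddCommGroup M] [Module ℚ M] (K : Submodule ℚ M)
    [FiniteDimensional ℚ K] (l : M →ₗ[ℚ] ℚ) (h : ∃ k ∈ K, l k ≠ 0) :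
    Module.finrank ℚ (K ⊓ LinearMap.ker l : Submodule ℚ M) + 1 = Module.finrank ℚ K := by
  have h1 := LinearMap.finrank_range_add_finrank_ker (l.domRestrict K)
  have hs : Function.Surjective (l.domRestrict K) := by
    apply LinearMap.surjective
    obtain ⟨k, hk, hk'⟩ := h
    intro h0
    exact hk' (by simpa using LinearMap.congr_fun h0 ⟨k, hk⟩)
  rw [LinearMap.range_eq_top.2 hs, finrank_top, Module.finrank_self] at h1
  have h2 : Module.finrank ℚ (LinearMap.ker (l.domRestrict K)) =
      Module.finrank ℚ (K ⊓ LinearMap.ker l : Submodule ℚ M) := by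
    have h3 : (LinearMap.ker (l.domRestrict K)).map K.subtype = K ⊓ LinearMap.ker l := by
      rw [LinearMap.ker_domRestrict, Submodule.map_comap_subtype]
    rw [← h3, Submodule.finrank_map_subtype_eq]
  omega

theorem inf_ker_of_forall {M : Type*} [AddCommGroup M] [Module ℚ M] (K : Submodule ℚ M)
    (l : M →ₗ[ℚ] ℚ) (h : ∀ k ∈ K, l k = 0) : K ⊓ LinearMap.ker l = K :=
  inf_eq_left.2 fun k hk => h k hk

theorem finrank_le_finrank_inf_ker {M : Type*} [AddCommGroup M] [Module ℚ M] (K : Submodule ℚ M)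
    [FiniteDimensional ℚ K] (l : M →ₗ[ℚ] ℚ) :
    Module.finrank ℚ K ≤ Module.finrank ℚ (K ⊓ LinearMap.ker l : Submodule ℚ M) + 1 := by
  by_cases h : ∃ k ∈ K, l k ≠ 0
  · exact (finrank_inf_ker_of_ne K l h).ge
  · push Not at h
    rw [inf_ker_of_forall K l h]
    omega

/-- Evaluation of the difference of two functions at `w`. -/
def diffAt (α : Type*) (w : α) : ((α → ℚ) × (α → ℚ)) →ₗ[ℚ] ℚ :=
  (LinearMap.proj w).comp (LinearMap.fst ℚ (α → ℚ) (α → ℚ)) -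
    (LinearMap.proj w).comp (LinearMap.snd ℚ (α → ℚ) (α → ℚ))

theorem diffAt_apply (w : α) (p : (α → ℚ) × (α → ℚ)) : diffAt α w p = p.1 w - p.2 w := rfl

/-- Pairs of functions that agree on `W`. -/
def agreeOn (W : Set α) : Submodule ℚ ((α → ℚ) × (α → ℚ)) where
  carrier := {p | ∀ w ∈ W, p.1 w = p.2 w}
  add_mem' := by
    intro p q hp hq w hw
    simp [hp w hw, hq w hw]
  zero_mem' := by simp
  smul_mem' := by
    intro c p hp w hw
    simp [hp w hw]

open Classical in
/-- Restrictions of a function to `V₁` and to `V₂`. -/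
noncomputable def restrictPair (V₁ V₂ : Set α) : (α → ℚ) →ₗ[ℚ] ((α → ℚ) × (α → ℚ)) where
  toFun h := (fun x => if x ∈ V₁ then h x else 0, fun x => if x ∈ V₂ then h x else 0)
  map_add' h k := by ext x <;> simp <;> split_ifs <;> simp
  map_smul' c h := by ext x <;> simp

/-- A locally constant function on a union is a pair of locally constant functions that agree on the
overlap: by `h₁` and `h₂` each edge sees only its own side. -/
theorem finrank_locConst_union {V₁ V₂ : Set α} {F₁ F₂ : Set β}
    (h₁ : ∀ e ∈ F₁, ∀ x y, I.IsLink e x y → x ∈ V₁ ∪ V₂ → y ∈ V₁ ∪ V₂ → x ∈ V₁ ∧ y ∈ V₁)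
    (h₂ : ∀ e ∈ F₂, ∀ x y, I.IsLink e x y → x ∈ V₁ ∪ V₂ → y ∈ V₁ ∪ V₂ → x ∈ V₂ ∧ y ∈ V₂) :
    Module.finrank ℚ (I.locConst (V₁ ∪ V₂) (F₁ ∪ F₂)) =
      Module.finrank ℚ ((I.locConst V₁ F₁).prod (I.locConst V₂ F₂) ⊓ agreeOn (V₁ ∩ V₂) :
        Submodule ℚ ((α → ℚ) × (α → ℚ))) := by
  classical
  have hmap : (I.locConst (V₁ ∪ V₂) (F₁ ∪ F₂)).map (restrictPair V₁ V₂) =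
      (I.locConst V₁ F₁).prod (I.locConst V₂ F₂) ⊓ agreeOn (V₁ ∩ V₂) := by
    ext ⟨f, g⟩
    constructor
    · rintro ⟨h, ⟨hh, hh'⟩, he⟩
      obtain ⟨rfl, rfl⟩ := Prod.ext_iff.1 he
      refine ⟨⟨⟨fun x hx => by simp [restrictPair, hx], fun e he x y hl hx hy => ?_⟩,
        ⟨fun x hx => by simp [restrictPair, hx], fun e he x y hl hx hy => ?_⟩⟩, ?_⟩
      · simpa [restrictPair, hx, hy] using hh' e (Or.inl he) x y hl (Or.inl hx) (Or.inl hy)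
      · simpa [restrictPair, hx, hy] using hh' e (Or.inr he) x y hl (Or.inr hx) (Or.inr hy)
      · rintro w ⟨hw, hw'⟩
        simp [restrictPair, hw, hw']
    · rintro ⟨⟨⟨hf, hf'⟩, ⟨hg, hg'⟩⟩, ha⟩
      simp only at hf hf' hg hg'
      have hg2 : ∀ x ∈ V₂, (if x ∈ V₁ then f x else g x) = g x := by
        intro x hx
        split_ifs with hx1
        · exact ha x ⟨hx1, hx⟩
        · rfl
      refine ⟨fun x => if x ∈ V₁ then f x else g x, ⟨fun x hx => ?_, ?_⟩, ?_⟩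
      · simp only [Set.mem_union, not_or] at hx
        simp [hx.1, hg x hx.2]
      · rintro e (he | he) x y hl hx hy
        · obtain ⟨hx, hy⟩ := h₁ e he x y hl hx hy
          simp [hx, hy, hf' e he x y hl hx hy]
        · obtain ⟨hx, hy⟩ := h₂ e he x y hl hx hy
          change (if x ∈ V₁ then f x else g x) = if y ∈ V₁ then f y else g y
          rw [hg2 x hx, hg2 y hy, hg' e he x y hl hx hy]
      · ext x
        · by_cases hx : x ∈ V₁
          · simp [restrictPair, hx]
          · simp [restrictPair, hx, hf x hx]
        · by_cases hx : x ∈ V₂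
          · simpa [restrictPair, hx] using hg2 x hx
          · simp [restrictPair, hx, hg x hx]
  rw [← hmap, ← LinearMap.range_domRestrict, LinearMap.finrank_range_of_inj]
  rintro ⟨f, hf, hf'⟩ ⟨g, hg, hg'⟩ h
  ext x
  obtain ⟨h1, h2⟩ := Prod.ext_iff.1 h
  have h1 := congrFun h1 x
  have h2 := congrFun h2 x
  by_cases hx : x ∈ V₁
  · simpa [restrictPair, hx] using h1
  by_cases hx' : x ∈ V₂
  · simpa [restrictPair, hx'] using h2
  · simp [hf x (by simp [hx, hx']), hg x (by simp [hx, hx'])]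

theorem indicator_mem_locConst (V : Set α) (F : Set β) (c : ℚ) :
    V.indicator (fun _ => c) ∈ I.locConst V F :=
  ⟨fun x hx => by simp [hx], fun e _ x y _ hx hy => by simp [hx, hy]⟩

theorem finrank_prod_submodule {M N : Type*} [AddCommGroup M] [Module ℚ M] [AddCommGroup N]
    [Module ℚ N] (K : Submodule ℚ M) (L : Submodule ℚ N) [FiniteDimensional ℚ K]
    [FiniteDimensional ℚ L] :
    FiniteDimensional ℚ (K.prod L) ∧
      Module.finrank ℚ (K.prod L) = Module.finrank ℚ K + Module.finrank ℚ L := by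
  let e : K.prod L ≃ₗ[ℚ] K × L :=
    { toFun := fun p => (⟨p.1.1, p.2.1⟩, ⟨p.1.2, p.2.2⟩)
      map_add' := fun _ _ => rfl
      map_smul' := fun _ _ => rfl
      invFun := fun p => ⟨(p.1.1, p.2.1), ⟨p.1.2, p.2.2⟩⟩
      left_inv := fun _ => rfl
      right_inv := fun _ => rfl }
  exact ⟨e.symm.finiteDimensional, by rw [e.finrank_eq, Module.finrank_prod]⟩

theorem agreeOn_empty : agreeOn (∅ : Set α) = ⊤ := by
  ext p; simp [agreeOn]

theorem agreeOn_singleton (w : α) : agreeOn ({w} : Set α) = LinearMap.ker (diffAt α w) := by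
  ext p; simp [agreeOn, diffAt_apply, sub_eq_zero]

theorem agreeOn_pair (u v : α) : agreeOn ({u, v} : Set α) =
    LinearMap.ker (diffAt α u) ⊓ LinearMap.ker (diffAt α v) := by
  ext p; simp [agreeOn, diffAt_apply, sub_eq_zero]

end Graph

/-! ### Parts of a graph and their component counts under gluing -/

/-- A part of an ambient graph: a set of vertices and a set of edges. -/
@[ext]
structure GraphPart (α β : Type*) where
  verts : Set α
  edges : Set β

namespace GraphPart

variable {α β : Type*}

/-- The union of two parts. -/
def union (P Q : GraphPart α β) : GraphPart α β := ⟨P.verts ∪ Q.verts, P.edges ∪ Q.edges⟩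

/-- Deletion of an edge. -/
def del (P : GraphPart α β) (e : β) : GraphPart α β := ⟨P.verts, P.edges \ {e}⟩

theorem verts_union (P Q : GraphPart α β) : (P.union Q).verts = P.verts ∪ Q.verts := rfl

theorem edges_union (P Q : GraphPart α β) : (P.union Q).edges = P.edges ∪ Q.edges := rfl

theorem union_comm (P Q : GraphPart α β) : P.union Q = Q.union P := by
  simp [union, Set.union_comm]

theorem union_assoc (P Q R : GraphPart α β) : (P.union Q).union R = P.union (Q.union R) := by
  simp [union, Set.union_assoc]

theorem del_union {P Q : GraphPart α β} {e : β} (he : e ∉ Q.edges) :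
    (P.union Q).del e = (P.del e).union Q := by
  simp only [union, del, Set.union_sdiff_distrib]
  rw [Set.sdiff_singleton_eq_self he]

variable (I : Graph α β)

/-- A part with finitely many vertices that contains the ends of its edges. -/
structure Closed (P : GraphPart α β) : Prop where
  finite : P.verts.Finite
  mem : ∀ e ∈ P.edges, ∀ x y, I.IsLink e x y → x ∈ P.verts

/-- The number of components of `P - S`. -/
noncomputable def comps (P : GraphPart α β) (S : Set α) : ℕ :=
  Module.finrank ℚ (I.locConst (P.verts \ S) P.edges)

/-- The number of components of `P - S` minus twice the number of vertices of `S` in `P`. -/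
noncomputable def bal (P : GraphPart α β) (S : Set α) : ℤ :=
  (P.comps I S : ℤ) - 2 * ((S ∩ P.verts).ncard : ℤ)

/-- `u` and `v` are in the same component of `P - S`. -/
def Linked (P : GraphPart α β) (S : Set α) (u v : α) : Prop :=
  ∀ f ∈ I.locConst (P.verts \ S) P.edges, f u = f v

variable {I} {P Q : GraphPart α β} {S S' : Set α} {u v w : α} {e : β}

theorem Linked.symm (h : P.Linked I S u v) : P.Linked I S v u := fun f hf => (h f hf).symm

theorem Linked.trans (h : P.Linked I S u v) (h' : P.Linked I S v w) : P.Linked I S u w :=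
  fun f hf => (h f hf).trans (h' f hf)

theorem Closed.union (hP : P.Closed I) (hQ : Q.Closed I) : (P.union Q).Closed I where
  finite := hP.finite.union hQ.finite
  mem := by
    rintro e (he | he) x y h
    exacts [Or.inl (hP.mem e he x y h), Or.inr (hQ.mem e he x y h)]

theorem Closed.del (hP : P.Closed I) (e : β) : (P.del e).Closed I where
  finite := hP.finite
  mem := fun f hf x y h => hP.mem f hf.1 x y h

theorem diff_congr {V : Set α} (h : S ∩ V = S' ∩ V) : V \ S = V \ S' := by
  rw [← Set.sdiff_inter_self_eq_sdiff, h, Set.sdiff_inter_self_eq_sdiff]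

theorem comps_congr (h : S ∩ P.verts = S' ∩ P.verts) : P.comps I S = P.comps I S' := by
  rw [comps, comps, diff_congr h]

theorem bal_congr (h : S ∩ P.verts = S' ∩ P.verts) : P.bal I S = P.bal I S' := by
  rw [bal, bal, comps_congr h, h]

theorem linked_congr (h : S ∩ P.verts = S' ∩ P.verts) :
    P.Linked I S u v ↔ P.Linked I S' u v := by
  rw [Linked, Linked, diff_congr h]

theorem Closed.finiteDimensional (hP : P.Closed I) (S : Set α) :
    FiniteDimensional ℚ (I.locConst (P.verts \ S) P.edges) :=
  Graph.finiteDimensional_locConst (hP.finite.subset Set.sdiff_subset) _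

theorem Linked.union_left (h : P.Linked I S u v) (hu : u ∈ P.verts)
    (hv : v ∈ P.verts) : (P.union Q).Linked I S u v := by
  classical
  rintro f ⟨hf, hf'⟩
  have := h (fun x => if x ∈ P.verts then f x else 0) ⟨fun x hx => ?_, fun e he x y hl hx hy => ?_⟩
  · simpa [hu, hv] using this
  · by_cases hxP : x ∈ P.verts
    · have hxS : x ∈ S := by_contra fun hS => hx ⟨hxP, hS⟩
      simp [hf x (fun hh => hh.2 hxS)]
    · simp [hxP]
  · simpa [hx.1, hy.1] using hf' e (Or.inl he) x y hl ⟨Or.inl hx.1, hx.2⟩ ⟨Or.inl hy.1, hy.2⟩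

theorem Linked.union_right (h : Q.Linked I S u v) (hu : u ∈ Q.verts)
    (hv : v ∈ Q.verts) : (P.union Q).Linked I S u v := by
  rw [union_comm]
  exact h.union_left hu hv

theorem Linked.anti (h : P.Linked I S u v) (hu : u ∉ S) (hv : v ∉ S) : P.Linked I ∅ u v := by
  classical
  rintro f ⟨hf, hf'⟩
  have := h (fun x => if x ∈ S then 0 else f x) ⟨fun x hx => ?_, fun e he x y hl hx hy => ?_⟩
  · simpa [hu, hv] using this
  · by_cases hxS : x ∈ S
    · simp [hxS]
    · simp only [hxS, if_false]
      exact hf x fun hh => hx ⟨hh.1, hxS⟩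
  · simpa [hx.2, hy.2] using hf' e he x y hl (by simpa using hx.1) (by simpa using hy.1)

/-- A function separating `u` from `w` extends over `Q` by the constant `f w`. -/
theorem not_linked_union_of_inter_eq_singleton (hP : P.Closed I) (hQ : Q.Closed I)
    (hW : P.verts ∩ Q.verts = {w}) (hu : u ∈ P.verts) (hv : v ∈ Q.verts)
    (h : ¬ P.Linked I ∅ u w) : ¬ (P.union Q).Linked I ∅ u v := by
  classical
  have hw : w ∈ P.verts ∩ Q.verts := by rw [hW]; rfl
  simp only [Linked, not_forall] at h ⊢
  obtain ⟨f, ⟨hf, hf'⟩, hne⟩ := h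
  simp only [Set.sdiff_empty] at hf hf' ⊢
  refine ⟨fun x => if x ∈ Q.verts then f w else f x, ⟨fun x hx => ?_, ?_⟩, ?_⟩
  · have hx' := not_or.1 hx
    simp [hx'.2, hf x hx'.1]
  · have hval' : ∀ x ∈ P.verts, (if x ∈ Q.verts then f w else f x) = f x := by
      intro x hx
      split_ifs with hxQ
      · have : x ∈ P.verts ∩ Q.verts := ⟨hx, hxQ⟩
        rw [hW] at this
        rw [this]
      · rfl
    rintro e (he | he) x y hl - -
    · have hx := hP.mem e he x y hl
      have hy := hP.mem e he y x hl.symm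
      change (if x ∈ Q.verts then f w else f x) = if y ∈ Q.verts then f w else f y
      rw [hval' x hx, hval' y hy, hf' e he x y hl hx hy]
    · simp [hQ.mem e he x y hl, hQ.mem e he y x hl.symm]
  · have : (if u ∈ Q.verts then f w else f u) = f u := by
      split_ifs with huQ
      · have : u ∈ P.verts ∩ Q.verts := ⟨hu, huQ⟩
        rw [hW] at this
        rw [this]
      · rfl
    simp only [this, hv, if_true]
    exact hne

theorem comps_union (hP : P.Closed I) (hQ : Q.Closed I) (S : Set α) :
    (P.union Q).comps I S =
      Module.finrank ℚ ((I.locConst (P.verts \ S) P.edges).prod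
        (I.locConst (Q.verts \ S) Q.edges) ⊓ Graph.agreeOn ((P.verts ∩ Q.verts) \ S) :
          Submodule ℚ ((α → ℚ) × (α → ℚ))) := by
  rw [comps, verts_union, edges_union, Set.union_sdiff_distrib, Graph.finrank_locConst_union]
  · have : P.verts \ S ∩ (Q.verts \ S) = (P.verts ∩ Q.verts) \ S := by
      ext x
      simp only [Set.mem_inter_iff, Set.mem_sdiff]
      tauto
    rw [this]
  · rintro e he x y hl hx hy
    have hx' := hP.mem e he x y hl
    have hy' := hP.mem e he y x hl.symm
    simp only [Set.mem_union, Set.mem_sdiff] at hx hy ⊢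
    tauto
  · rintro e he x y hl hx hy
    have hx' := hQ.mem e he x y hl
    have hy' := hQ.mem e he y x hl.symm
    simp only [Set.mem_union, Set.mem_sdiff] at hx hy ⊢
    tauto

theorem comps_union_of_diff_eq_empty (hP : P.Closed I) (hQ : Q.Closed I)
    (h : (P.verts ∩ Q.verts) \ S = ∅) : (P.union Q).comps I S = P.comps I S + Q.comps I S := by
  have := hP.finiteDimensional S
  have := hQ.finiteDimensional S
  rw [comps_union hP hQ, h, Graph.agreeOn_empty, inf_top_eq, (Graph.finrank_prod_submodule _ _).2]
  rfl

theorem finrank_prod_inf_ker_diffAt (hP : P.Closed I) (hQ : Q.Closed I)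
    (hwP : w ∈ P.verts) (hwS : w ∉ S) :
    Module.finrank ℚ ((I.locConst (P.verts \ S) P.edges).prod
        (I.locConst (Q.verts \ S) Q.edges) ⊓ LinearMap.ker (Graph.diffAt α w) :
          Submodule ℚ ((α → ℚ) × (α → ℚ))) + 1 = P.comps I S + Q.comps I S := by
  classical
  have := hP.finiteDimensional S
  have := hQ.finiteDimensional S
  obtain ⟨h1, h2⟩ := Graph.finrank_prod_submodule (I.locConst (P.verts \ S) P.edges)
    (I.locConst (Q.verts \ S) Q.edges)
  rw [Graph.finrank_inf_ker_of_ne, h2]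
  · rfl
  · refine ⟨((P.verts \ S).indicator fun _ => 1, 0),
      ⟨Graph.indicator_mem_locConst (P.verts \ S) P.edges 1, Submodule.zero_mem _⟩, ?_⟩
    simp [Graph.diffAt_apply, hwP, hwS]

theorem comps_union_of_diff_eq_singleton (hP : P.Closed I) (hQ : Q.Closed I)
    (h : (P.verts ∩ Q.verts) \ S = {w}) :
    (P.union Q).comps I S + 1 = P.comps I S + Q.comps I S := by
  have hw : w ∈ (P.verts ∩ Q.verts) \ S := by rw [h]; rfl
  rw [comps_union hP hQ, h, Graph.agreeOn_singleton,
    finrank_prod_inf_ker_diffAt hP hQ hw.1.1 hw.2]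

/-- Agreement at `u` already implies agreement at `v`, so only one dimension is lost. -/
theorem comps_union_of_linked (hP : P.Closed I) (hQ : Q.Closed I)
    (h : (P.verts ∩ Q.verts) \ S = {u, v}) (h1 : P.Linked I S u v) (h2 : Q.Linked I S u v) :
    (P.union Q).comps I S + 1 = P.comps I S + Q.comps I S := by
  have hu : u ∈ (P.verts ∩ Q.verts) \ S := by rw [h]; simp
  rw [comps_union hP hQ, h, Graph.agreeOn_pair, ← inf_assoc, Graph.inf_ker_of_forall,
    finrank_prod_inf_ker_diffAt hP hQ hu.1.1 hu.2]
  rintro ⟨f, g⟩ ⟨⟨hf, hg⟩, hfg⟩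
  have h3 : f u - g u = 0 := hfg
  have h4 : f u = f v := h1 f hf
  have h5 : g u = g v := h2 g hg
  rw [Graph.diffAt_apply]
  simp only
  linarith

theorem comps_union_of_not_linked (hP : P.Closed I) (hQ : Q.Closed I)
    (h : (P.verts ∩ Q.verts) \ S = {u, v}) (h1 : ¬ P.Linked I S u v) :
    (P.union Q).comps I S + 2 = P.comps I S + Q.comps I S := by
  classical
  have := hP.finiteDimensional S
  have := hQ.finiteDimensional S
  have := (Graph.finrank_prod_submodule (I.locConst (P.verts \ S) P.edges)
    (I.locConst (Q.verts \ S) Q.edges)).1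
  have hu : u ∈ (P.verts ∩ Q.verts) \ S := by rw [h]; simp
  have hv : v ∈ (P.verts ∩ Q.verts) \ S := by rw [h]; simp
  have h3 := finrank_prod_inf_ker_diffAt hP hQ hu.1.1 hu.2
  have h4 := Graph.finrank_inf_ker_of_ne ((I.locConst (P.verts \ S) P.edges).prod
    (I.locConst (Q.verts \ S) Q.edges) ⊓ LinearMap.ker (Graph.diffAt α u)) (Graph.diffAt α v) ?_
  · rw [comps_union hP hQ, h, Graph.agreeOn_pair, ← inf_assoc]
    omega
  · simp only [Linked, not_forall] at h1
    obtain ⟨f, hf, hfuv⟩ := h1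
    -- The function `f` separates `u` from `v` on `P`. Paired with the constant `f u` on `Q`, it
    -- satisfies the condition at `u` and violates the one at `v`, so the two conditions are
    -- independent.
    refine ⟨(f, (Q.verts \ S).indicator fun _ => f u),
      ⟨⟨hf, Graph.indicator_mem_locConst (Q.verts \ S) Q.edges (f u)⟩, ?_⟩, ?_⟩
    · simp [Graph.diffAt_apply, hu.1.2, hu.2]
    · simp only [Graph.diffAt_apply]
      rw [Set.indicator_of_mem (show v ∈ Q.verts \ S from ⟨hv.1.2, hv.2⟩), sub_ne_zero]
      exact fun hh => hfuv hh.symm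

end GraphPart

/-! ### The balance of a one-sum and of a two-sum -/

namespace GraphPart

variable {α β : Type*} (I : Graph α β)

/-- `P` and `Q` are edge-disjoint and share exactly the vertex `w`. -/
structure OneSum (P Q : GraphPart α β) (w : α) : Prop where
  left : P.Closed I
  right : Q.Closed I
  inter : P.verts ∩ Q.verts = {w}
  disj : Disjoint P.edges Q.edges

/-- `P` and `Q` are edge-disjoint and share exactly the two vertices `u` and `v`. -/
structure TwoSum (P Q : GraphPart α β) (u v : α) : Prop where
  left : P.Closed I
  right : Q.Closed I
  inter : P.verts ∩ Q.verts = {u, v}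
  ne : u ≠ v
  disj : Disjoint P.edges Q.edges

variable {I} {P Q : GraphPart α β} {S S' : Set α} {u v w : α} {e : β}

theorem OneSum.symm (h : OneSum I P Q w) : OneSum I Q P w :=
  ⟨h.right, h.left, by rw [Set.inter_comm, h.inter], h.disj.symm⟩

theorem TwoSum.symm (h : TwoSum I P Q u v) : TwoSum I Q P u v :=
  ⟨h.right, h.left, by rw [Set.inter_comm, h.inter], h.ne, h.disj.symm⟩

theorem TwoSum.swap (h : TwoSum I P Q u v) : TwoSum I P Q v u :=
  ⟨h.left, h.right, by rw [h.inter, Set.pair_comm], h.ne.symm, h.disj⟩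

theorem TwoSum.del (h : TwoSum I P Q u v) (e : β) : TwoSum I (P.del e) Q u v :=
  ⟨h.left.del e, h.right, h.inter, h.ne, h.disj.mono_left Set.sdiff_subset⟩

theorem OneSum.mem_left (h : OneSum I P Q w) : w ∈ P.verts :=
  (h.inter.ge (Set.mem_singleton w)).1

theorem OneSum.mem_right (h : OneSum I P Q w) : w ∈ Q.verts := h.symm.mem_left

theorem TwoSum.fst_mem (h : TwoSum I P Q u v) : u ∈ P.verts :=
  (h.inter.ge (Set.mem_insert u _)).1

theorem TwoSum.snd_mem (h : TwoSum I P Q u v) : v ∈ P.verts := h.swap.fst_mem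

theorem ncard_inter_union (hP : P.Closed I) (hQ : Q.Closed I) (S : Set α) :
    (S ∩ (P.union Q).verts).ncard + (S ∩ (P.verts ∩ Q.verts)).ncard =
      (S ∩ P.verts).ncard + (S ∩ Q.verts).ncard := by
  rw [verts_union, Set.inter_union_distrib_left, Set.inter_inter_distrib_left]
  exact Set.ncard_union_add_ncard_inter _ _ (hP.finite.subset Set.inter_subset_right)
    (hQ.finite.subset Set.inter_subset_right)

theorem bal_union_of_inter_eq_empty (hP : P.Closed I) (hQ : Q.Closed I)
    (h : P.verts ∩ Q.verts = ∅) : (P.union Q).bal I S = P.bal I S + Q.bal I S := by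
  have h1 := ncard_inter_union hP hQ S
  have h2 := comps_union_of_diff_eq_empty (S := S) hP hQ (by rw [h, Set.empty_sdiff])
  rw [h, Set.inter_empty, Set.ncard_empty] at h1
  simp only [bal]
  omega

/-- The deleted vertex `w` is charged 2 in both parts, hence once too often. For a two-sum with both
terminals deleted the correction is 4 for the same reason. -/
theorem OneSum.bal_of_mem (h : OneSum I P Q w) (hw : w ∈ S) :
    (P.union Q).bal I S = P.bal I S + Q.bal I S + 2 := by
  have h1 := ncard_inter_union h.left h.right S
  have h2 := comps_union_of_diff_eq_empty (S := S) h.left h.right (by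
    rw [h.inter]
    exact Set.sdiff_eq_empty.2 (by simpa using hw))
  have h3 : S ∩ {w} = {w} := by simpa using hw
  rw [h.inter, h3, Set.ncard_singleton] at h1
  simp only [bal]
  omega

theorem OneSum.bal_of_notMem (h : OneSum I P Q w) (hw : w ∉ S) :
    (P.union Q).bal I S = P.bal I S + Q.bal I S - 1 := by
  have h1 := ncard_inter_union h.left h.right S
  have h2 := comps_union_of_diff_eq_singleton (S := S) (w := w) h.left h.right (by
    rw [h.inter]
    exact sdiff_eq_left.2 (by simpa using hw))
  have h3 : S ∩ {w} = ∅ := by simpa using hw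
  rw [h.inter, h3, Set.ncard_empty] at h1
  simp only [bal]
  omega

theorem TwoSum.bal_of_mem_mem (h : TwoSum I P Q u v) (hu : u ∈ S) (hv : v ∈ S) :
    (P.union Q).bal I S = P.bal I S + Q.bal I S + 4 := by
  have h1 := ncard_inter_union h.left h.right S
  have h2 := comps_union_of_diff_eq_empty (S := S) h.left h.right (by
    rw [h.inter]
    exact Set.sdiff_eq_empty.2 (by simp [Set.insert_subset_iff, hu, hv]))
  have h3 : S ∩ {u, v} = {u, v} :=
    Set.inter_eq_right.2 (by simp [Set.insert_subset_iff, hu, hv])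
  rw [h.inter, h3, Set.ncard_pair h.ne] at h1
  simp only [bal]
  omega

theorem TwoSum.bal_of_notMem_mem (h : TwoSum I P Q u v) (hu : u ∉ S) (hv : v ∈ S) :
    (P.union Q).bal I S = P.bal I S + Q.bal I S + 1 := by
  have h1 := ncard_inter_union h.left h.right S
  have h2 := comps_union_of_diff_eq_singleton (S := S) (w := u) h.left h.right (by
    rw [h.inter]
    ext x
    simp only [Set.mem_sdiff, Set.mem_insert_iff, Set.mem_singleton_iff]
    constructor
    · rintro ⟨rfl | rfl, hx⟩
      exacts [rfl, absurd hv hx]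
    · rintro rfl
      exact ⟨Or.inl rfl, hu⟩)
  have h3 : S ∩ {u, v} = {v} := by
    ext x
    simp only [Set.mem_inter_iff, Set.mem_insert_iff, Set.mem_singleton_iff]
    constructor
    · rintro ⟨hx, rfl | rfl⟩
      exacts [absurd hx hu, rfl]
    · rintro rfl
      exact ⟨hv, Or.inr rfl⟩
  rw [h.inter, h3, Set.ncard_singleton] at h1
  simp only [bal]
  omega

theorem TwoSum.bal_of_mem_notMem (h : TwoSum I P Q u v) (hu : u ∈ S) (hv : v ∉ S) :
    (P.union Q).bal I S = P.bal I S + Q.bal I S + 1 :=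
  h.swap.bal_of_notMem_mem hv hu

theorem pair_sdiff_of_notMem (hu : u ∉ S) (hv : v ∉ S) : ({u, v} : Set α) \ S = {u, v} := by
  rw [sdiff_eq_left, Set.disjoint_left]
  rintro x (rfl | rfl)
  exacts [hu, hv]

theorem pair_inter_of_notMem (hu : u ∉ S) (hv : v ∉ S) : S ∩ ({u, v} : Set α) = ∅ := by
  rw [← Set.disjoint_iff_inter_eq_empty, Set.disjoint_right]
  rintro x (rfl | rfl)
  exacts [hu, hv]

theorem TwoSum.bal_of_linked (h : TwoSum I P Q u v) (hu : u ∉ S) (hv : v ∉ S)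
    (hP : P.Linked I S u v) (hQ : Q.Linked I S u v) :
    (P.union Q).bal I S = P.bal I S + Q.bal I S - 1 := by
  have h1 := ncard_inter_union h.left h.right S
  have h2 := comps_union_of_linked (S := S) (u := u) (v := v) h.left h.right (by
    rw [h.inter, pair_sdiff_of_notMem hu hv]) hP hQ
  rw [h.inter, pair_inter_of_notMem hu hv, Set.ncard_empty] at h1
  simp only [bal]
  omega

/-- Both identifications merge components, whereas if both parts link `u` and `v` the second one
merges nothing. -/
theorem TwoSum.bal_of_not_linked (h : TwoSum I P Q u v) (hu : u ∉ S) (hv : v ∉ S)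
    (hP : ¬ P.Linked I S u v) :
    (P.union Q).bal I S = P.bal I S + Q.bal I S - 2 := by
  have h1 := ncard_inter_union h.left h.right S
  have h2 := comps_union_of_not_linked (S := S) (u := u) (v := v) h.left h.right (by
    rw [h.inter, pair_sdiff_of_notMem hu hv]) hP
  rw [h.inter, pair_inter_of_notMem hu hv, Set.ncard_empty] at h1
  simp only [bal]
  omega

theorem TwoSum.bal_of_not_linked_right (h : TwoSum I P Q u v) (hu : u ∉ S) (hv : v ∉ S)
    (hQ : ¬ Q.Linked I S u v) :
    (P.union Q).bal I S = P.bal I S + Q.bal I S - 2 := by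
  rw [union_comm, h.symm.bal_of_not_linked hu hv hQ, add_comm]

/-- Two vertex sets that agree on the common vertices of `P` and `Q` can be combined. -/
theorem exists_combination (S₁ S₂ : Set α)
    (h : ∀ x ∈ P.verts ∩ Q.verts, x ∈ S₁ ↔ x ∈ S₂) :
    ∃ S : Set α, S ∩ P.verts = S₁ ∩ P.verts ∧ S ∩ Q.verts = S₂ ∩ Q.verts := by
  refine ⟨S₁ ∩ P.verts ∪ S₂ ∩ Q.verts, ?_, ?_⟩
  · ext x
    have := h x
    simp only [Set.mem_inter_iff, Set.mem_union] at this ⊢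
    tauto
  · ext x
    have := h x
    simp only [Set.mem_inter_iff, Set.mem_union] at this ⊢
    tauto

theorem mem_iff_of_inter_eq {V : Set α} (h : S ∩ V = S' ∩ V) {x : α} (hx : x ∈ V) :
    x ∈ S ↔ x ∈ S' := by
  have := Set.ext_iff.1 h x
  simpa [hx] using this

/-- The edge disappears together with its deleted end anyway. -/
theorem bal_del_of_inc (hu : u ∈ S) (he : I.Inc e u) : (P.del e).bal I S = P.bal I S := by
  have : I.locConst ((P.del e).verts \ S) (P.del e).edges = I.locConst (P.verts \ S) P.edges := by
    ext f
    refine ⟨fun ⟨hf, hf'⟩ => ⟨hf, fun e' he' x y hl hx hy => ?_⟩,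
      fun ⟨hf, hf'⟩ => ⟨hf, fun e' he' => hf' e' he'.1⟩⟩
    by_cases hee : e' = e
    · subst hee
      rcases he.eq_or_eq_of_isLink hl with rfl | rfl
      exacts [absurd hu hx.2, absurd hu hy.2]
    · exact hf' e' ⟨he', hee⟩ x y hl hx hy
  rw [bal, comps, this]
  rfl

theorem bal_del_le (hP : P.Closed I) (e : β) (S : Set α) :
    (P.del e).bal I S ≤ P.bal I S + 1 := by
  have := hP.finiteDimensional S
  have := (hP.del e).finiteDimensional S
  suffices h : (P.del e).comps I S ≤ P.comps I S + 1 by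
    simp only [bal]
    change ((P.del e).comps I S : ℤ) - 2 * ((S ∩ P.verts).ncard : ℤ) ≤ _
    omega
  by_cases hl : ∃ x y, I.IsLink e x y
  · obtain ⟨x, y, hl⟩ := hl
    let l : (α → ℚ) →ₗ[ℚ] ℚ :=
      LinearMap.proj (R := ℚ) (φ := fun _ : α => ℚ) x -
        LinearMap.proj (R := ℚ) (φ := fun _ : α => ℚ) y
    refine (Graph.finrank_le_finrank_inf_ker _ l).trans (Nat.add_le_add_right ?_ 1)
    refine Submodule.finrank_mono ?_
    rintro f ⟨⟨hf, hf'⟩, hl'⟩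
    have hl' : f x - f y = 0 := hl'
    refine ⟨hf, fun e' he' x' y' hl'' hx hy => ?_⟩
    by_cases hee : e' = e
    · subst hee
      rcases hl.eq_and_eq_or_eq_and_eq hl'' with ⟨rfl, rfl⟩ | ⟨rfl, rfl⟩ <;> linarith
    · exact hf' e' ⟨he', hee⟩ x' y' hl'' hx hy
  · refine (Submodule.finrank_mono ?_).trans (Nat.le_succ _)
    rintro f ⟨hf, hf'⟩
    refine ⟨hf, fun e' he' x y hl' => ?_⟩
    by_cases hee : e' = e
    · subst hee
      exact absurd ⟨x, y, hl'⟩ hl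
    · exact hf' e' ⟨he', hee⟩ x y hl'

/-- One more deleted vertex costs at most 2, and it destroys at most one component, namely when it
is isolated. -/
theorem bal_insert_ge (hP : P.Closed I) (u : α) (S : Set α) :
    P.bal I S - 3 ≤ P.bal I (insert u S) := by
  have := hP.finiteDimensional S
  have := hP.finiteDimensional (insert u S)
  have h1 : P.comps I S ≤ P.comps I (insert u S) + 1 := by
    let l : (α → ℚ) →ₗ[ℚ] ℚ := LinearMap.proj u
    refine (Graph.finrank_le_finrank_inf_ker _ l).trans (Nat.add_le_add_right ?_ 1)
    refine Submodule.finrank_mono ?_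
    rintro f ⟨⟨hf, hf'⟩, hu⟩
    have hu : f u = 0 := hu
    refine ⟨fun x hx => ?_, fun e he x y hl hx hy => hf' e he x y hl
      ⟨hx.1, fun h => hx.2 (Or.inr h)⟩ ⟨hy.1, fun h => hy.2 (Or.inr h)⟩⟩
    by_cases hxu : x = u
    · rw [hxu, hu]
    · exact hf x fun hh => hx ⟨hh.1, by simp [hxu, hh.2]⟩
  have h2 : (insert u S ∩ P.verts).ncard ≤ (S ∩ P.verts).ncard + 1 := by
    refine le_trans (Set.ncard_le_ncard (t := insert u (S ∩ P.verts)) ?_ ?_)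
      (Set.ncard_insert_le _ _)
    · rintro x ⟨rfl | hx, hx'⟩
      exacts [Or.inl rfl, Or.inr ⟨hx, hx'⟩]
    · exact (hP.finite.subset Set.inter_subset_right).insert _
  simp only [bal]
  omega

theorem one_le_bal_of_inter_eq_empty (hP : P.Closed I) (hu : u ∈ P.verts)
    (hS : S ∩ P.verts = ∅) : 1 ≤ P.bal I S := by
  have := hP.finiteDimensional S
  have huS : u ∉ S := fun h => (Set.ext_iff.1 hS u).1 ⟨h, hu⟩
  have : 0 < P.comps I S := by
    rw [comps, Module.finrank_pos_iff]
    refine ⟨⟨_, Graph.indicator_mem_locConst (P.verts \ S) P.edges 1⟩, 0, fun h => ?_⟩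
    have := congrFun (congrArg Subtype.val h) u
    simp [hu, huS] at this
  simp only [bal, hS, Set.ncard_empty]
  omega

theorem bal_eq_of_verts_eq_singleton (hV : P.verts = {u}) (hu : u ∈ S) : P.bal I S = -2 := by
  have h1 : P.comps I S = 0 := by
    have : I.locConst (P.verts \ S) P.edges = ⊥ := by
      rw [eq_bot_iff]
      rintro f ⟨hf, -⟩
      have : f = 0 := by
        ext x
        refine hf x ?_
        rintro ⟨hx, hxS⟩
        rw [hV] at hx
        exact hxS (by rwa [Set.mem_singleton_iff.1 hx])
      exact this
    rw [comps, this, finrank_bot]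
  have h2 : S ∩ P.verts = {u} := by rw [hV]; simpa using hu
  simp [bal, h1, h2]

end GraphPart

/-! ### Balance profiles of two-terminal parts -/

namespace GraphPart

variable {α β : Type*} (I : Graph α β)

/-- The part `G` is `1/2`-tough and connected, in terms of `bal`. -/
def Tough (G : GraphPart α β) : Prop :=
  ∀ S, G.bal I S ≤ 1 ∧ (S ∩ G.verts ≠ ∅ → G.bal I S ≤ 0)

/-- The deletion of the edge `e` destroys `1/2`-toughness. -/
def Critical (G : GraphPart α β) (e : β) : Prop :=
  ∃ S, 1 ≤ (G.del e).bal I S ∧ (S ∩ G.verts = ∅ → 2 ≤ (G.del e).bal I S)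

/-- Basic properties of a series-parallel part with terminals `u` and `v`. -/
structure Base (P : GraphPart α β) (u v : α) : Prop where
  closed : P.Closed I
  fst_mem : u ∈ P.verts
  snd_mem : v ∈ P.verts
  ne : u ≠ v
  bal_empty : 1 ≤ P.bal I ∅
  bal_fst : -1 ≤ P.bal I {u}
  bal_snd : -1 ≤ P.bal I {v}
  linked : P.Linked I ∅ u v

/-- Upper bounds for `bal`, according to which terminals are deleted. -/
structure Prof (P : GraphPart α β) (u v : α) (k : ℤ) : Prop where
  both : ∀ S, u ∈ S → v ∈ S → P.bal I S ≤ k - 4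
  fst : ∀ S, u ∈ S → v ∉ S → P.bal I S ≤ -1
  snd : ∀ S, u ∉ S → v ∈ S → P.bal I S ≤ -1
  none : ∀ S, u ∉ S → v ∉ S → P.bal I S ≤ 1
  sep : ∀ S, u ∉ S → v ∉ S → ¬ P.Linked I S u v → P.bal I S ≤ 0

/-- Some set containing both terminals attains the value `k - 4` of `bal`. -/
def Low (P : GraphPart α β) (u v : α) (k : ℤ) : Prop :=
  ∃ S, u ∈ S ∧ v ∈ S ∧ k - 4 ≤ P.bal I S

/-- A tight set of `G` separates the terminal `u` from `v` by containing only `v`. -/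
def Half (G : GraphPart α β) (u v : α) : Prop := ∃ S, u ∉ S ∧ v ∈ S ∧ 0 ≤ G.bal I S

/-- Some edge at `u` separates `u` from `v`. -/
def CutEdge (P : GraphPart α β) (u v : α) : Prop :=
  ∃ e ∈ P.edges, I.Inc e u ∧ ¬ (P.del e).Linked I ∅ u v

variable {I} {P Q R X Y E G : GraphPart α β} {S T : Set α} {u v w x y : α} {e : β} {k l : ℤ}

theorem Base.swap (h : Base I P u v) : Base I P v u :=
  ⟨h.closed, h.snd_mem, h.fst_mem, h.ne.symm, h.bal_empty, h.bal_snd, h.bal_fst, h.linked.symm⟩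

theorem Prof.swap (h : Prof I P u v k) : Prof I P v u k :=
  ⟨fun S hu hv => h.both S hv hu, fun S hu hv => h.snd S hv hu, fun S hu hv => h.fst S hv hu,
    fun S hu hv => h.none S hv hu, fun S hu hv hl => h.sep S hv hu fun hh => hl hh.symm⟩

theorem Low.swap (h : Low I P u v k) : Low I P v u k :=
  let ⟨S, hu, hv, hS⟩ := h
  ⟨S, hv, hu, hS⟩

theorem Base.bal_of_fst (h : Base I P u v) (hS : S ∩ P.verts = {u}) : -1 ≤ P.bal I S := by
  rw [bal_congr (S' := {u})]
  · exact h.bal_fst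
  · rw [hS, Set.inter_eq_left.2 (by simpa using h.fst_mem)]

theorem Base.bal_of_empty (h : Base I P u v) (hS : S ∩ P.verts = ∅) : 1 ≤ P.bal I S := by
  rw [bal_congr (S' := ∅)]
  · exact h.bal_empty
  · simpa using hS

/-! ### Joins -/

theorem singleton_inter_of_notMem {V : Set α} (h : x ∉ V) : ({x} : Set α) ∩ V = ∅ := by simpa using h

theorem singleton_inter_of_mem {V : Set α} (h : x ∈ V) : ({x} : Set α) ∩ V = {x} := by simpa using h

theorem OneSum.fst_notMem (h : OneSum I P Q w) (hx : x ∈ P.verts) (hxw : x ≠ w) :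
    x ∉ Q.verts := by
  intro hxQ
  have : x ∈ P.verts ∩ Q.verts := ⟨hx, hxQ⟩
  rw [h.inter] at this
  exact hxw this

theorem OneSum.base_bal_fst (h : OneSum I P Q w) (hP : Base I P x w) (hQ : Base I Q w y) :
    -1 ≤ (P.union Q).bal I {x} := by
  have hx := h.fst_notMem hP.fst_mem hP.ne
  have h1 := h.bal_of_notMem (S := {x}) (by simpa using hP.ne.symm)
  have h2 := hP.bal_fst
  have h3 := hQ.bal_of_empty (singleton_inter_of_notMem hx)
  omega

theorem OneSum.base (h : OneSum I P Q w) (hP : Base I P x w) (hQ : Base I Q w y) :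
    Base I (P.union Q) x y where
  closed := hP.closed.union hQ.closed
  fst_mem := Or.inl hP.fst_mem
  snd_mem := Or.inr hQ.snd_mem
  ne := by
    rintro rfl
    exact h.fst_notMem hP.fst_mem hP.ne hQ.snd_mem
  bal_empty := by
    have h1 := h.bal_of_notMem (S := ∅) (by simp)
    have h2 := hP.bal_empty
    have h3 := hQ.bal_empty
    omega
  bal_fst := h.base_bal_fst hP hQ
  bal_snd := by
    rw [union_comm]
    exact h.symm.base_bal_fst hQ.swap hP.swap
  linked := (hP.linked.union_left hP.fst_mem hP.snd_mem).trans
    (hQ.linked.union_right hQ.fst_mem hQ.snd_mem)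

theorem TwoSum.base (h : TwoSum I P Q u v) (hP : Base I P u v) (hQ : Base I Q u v) :
    Base I (P.union Q) u v where
  closed := hP.closed.union hQ.closed
  fst_mem := Or.inl hP.fst_mem
  snd_mem := Or.inl hP.snd_mem
  ne := h.ne
  bal_empty := by
    have h1 := h.bal_of_linked (S := ∅) (by simp) (by simp) hP.linked hQ.linked
    have h2 := hP.bal_empty
    have h3 := hQ.bal_empty
    omega
  bal_fst := by
    have h1 := h.bal_of_mem_notMem (S := {u}) (by simp) (by simpa using h.ne.symm)
    have h2 := hP.bal_fst
    have h3 := hQ.bal_fst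
    omega
  bal_snd := by
    have h1 := h.bal_of_notMem_mem (S := {v}) (by simpa using h.ne) (by simp)
    have h2 := hP.bal_snd
    have h3 := hQ.bal_snd
    omega
  linked := hP.linked.union_left hP.fst_mem hP.snd_mem

theorem OneSum.prof_fst (h : OneSum I P Q w) (hP : Prof I P x w k) (hQ : Prof I Q w y l)
    (hk : k ≤ 2) (hx : x ∈ S) (hy : y ∉ S) : (P.union Q).bal I S ≤ -1 := by
  by_cases hw : w ∈ S
  · have h1 := h.bal_of_mem hw
    have h2 := hP.both S hx hw
    have h3 := hQ.fst S hw hy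
    omega
  · have h1 := h.bal_of_notMem hw
    have h2 := hP.fst S hx hw
    have h3 := hQ.none S hw hy
    omega

/-- The bounds on `k` come from sets containing both ends: with `w` deleted one needs `2(k - 4) + 2
≤ k - 4`, that is `k ≤ 2`; with `w` kept one needs `-3 ≤ k - 4`, that is `1 ≤ k`. -/
theorem OneSum.prof (h : OneSum I P Q w) (hP : Prof I P x w k) (hQ : Prof I Q w y k)
    (hk : k ≤ 2) (hk1 : 1 ≤ k) (hx : x ∈ P.verts) (hw : w ∈ P.verts) (hw' : w ∈ Q.verts)
    (hy : y ∈ Q.verts) : Prof I (P.union Q) x y k where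
  both := by
    intro S hx hy
    by_cases hw : w ∈ S
    · have h1 := h.bal_of_mem hw
      have h2 := hP.both S hx hw
      have h3 := hQ.both S hw hy
      omega
    · have h1 := h.bal_of_notMem hw
      have h2 := hP.fst S hx hw
      have h3 := hQ.snd S hw hy
      omega
  fst := fun S hx hy => h.prof_fst hP hQ hk hx hy
  snd := fun S hx hy => by
    rw [union_comm]
    exact h.symm.prof_fst hQ.swap hP.swap hk hy hx
  none := by
    intro S hx hy
    by_cases hw : w ∈ S
    · have h1 := h.bal_of_mem hw
      have h2 := hP.snd S hx hw
      have h3 := hQ.fst S hw hy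
      omega
    · have h1 := h.bal_of_notMem hw
      have h2 := hP.none S hx hw
      have h3 := hQ.none S hw hy
      omega
  sep := by
    intro S hxS hyS hl
    by_cases hwS : w ∈ S
    · have h1 := h.bal_of_mem hwS
      have h2 := hP.snd S hxS hwS
      have h3 := hQ.fst S hwS hyS
      omega
    · have h1 := h.bal_of_notMem hwS
      have h2 := hP.none S hxS hwS
      have h3 := hQ.none S hwS hyS
      by_cases hPl : P.Linked I S x w
      · have hQl : ¬ Q.Linked I S w y := fun hQl =>
          hl ((hPl.union_left hx hw).trans (hQl.union_right hw' hy))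
        have h4 := hQ.sep S hwS hyS hQl
        omega
      · have h4 := hP.sep S hxS hwS hPl
        omega

/-- The parameter is additive because `(k - 4) + (l - 4) + 4 = (k + l) - 4`; the other bounds
reproduce themselves. -/
theorem TwoSum.prof (h : TwoSum I P Q u v) (hP : Prof I P u v k) (hQ : Prof I Q u v l) :
    Prof I (P.union Q) u v (k + l) where
  both := by
    intro S hu hv
    have h1 := h.bal_of_mem_mem hu hv
    have h2 := hP.both S hu hv
    have h3 := hQ.both S hu hv
    omega
  fst := by
    intro S hu hv
    have h1 := h.bal_of_mem_notMem hu hv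
    have h2 := hP.fst S hu hv
    have h3 := hQ.fst S hu hv
    omega
  snd := by
    intro S hu hv
    have h1 := h.bal_of_notMem_mem hu hv
    have h2 := hP.snd S hu hv
    have h3 := hQ.snd S hu hv
    omega
  none := by
    intro S hu hv
    have h2 := hP.none S hu hv
    have h3 := hQ.none S hu hv
    by_cases hPl : P.Linked I S u v
    · by_cases hQl : Q.Linked I S u v
      · have h1 := h.bal_of_linked hu hv hPl hQl
        omega
      · have h1 := h.bal_of_not_linked_right hu hv hQl
        omega
    · have h1 := h.bal_of_not_linked hu hv hPl
      omega
  sep := by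
    intro S hu hv hl
    have h2 := hP.none S hu hv
    have h3 := hQ.none S hu hv
    have h1 := h.bal_of_not_linked hu hv fun hPl => hl (hPl.union_left h.fst_mem h.snd_mem)
    omega

theorem OneSum.low (h : OneSum I P Q w) (hP : Low I P x w k) (hQ : Low I Q w y l)
    (hx : x ∈ P.verts) (hy : y ∈ Q.verts) : Low I (P.union Q) x y (k + l - 2) := by
  obtain ⟨S, hxS, hwS, hS⟩ := hP
  obtain ⟨T, hwT, hyT, hT⟩ := hQ
  obtain ⟨Z, hZ1, hZ2⟩ := exists_combination (P := P) (Q := Q) S T (by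
    rw [h.inter]
    rintro z rfl
    simp [hwS, hwT])
  refine ⟨Z, (mem_iff_of_inter_eq hZ1 hx).2 hxS, (mem_iff_of_inter_eq hZ2 hy).2 hyT, ?_⟩
  rw [h.bal_of_mem ((mem_iff_of_inter_eq hZ1 h.mem_left).2 hwS), bal_congr hZ1, bal_congr hZ2]
  omega

/-- A series join of parts always has a set containing both terminals with one component left. -/
theorem OneSum.low_one (h : OneSum I P Q w) (hP : Base I P x w) (hQ : Base I Q w y) :
    Low I (P.union Q) x y 1 := by
  have hx := h.fst_notMem hP.fst_mem hP.ne
  have hy := h.symm.fst_notMem hQ.snd_mem hQ.ne.symm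
  refine ⟨{x, y}, by simp, by simp, ?_⟩
  have h1 := h.bal_of_notMem (S := {x, y}) (by simp [hP.ne.symm, hQ.ne])
  have h2 := hP.bal_of_fst (S := {x, y}) (by
    rw [Set.insert_inter_of_mem hP.fst_mem, singleton_inter_of_notMem hy, insert_empty_eq])
  have h3 := hQ.swap.bal_of_fst (S := {x, y}) (by
    rw [Set.insert_inter_of_notMem hx, singleton_inter_of_mem hQ.snd_mem])
  omega

theorem TwoSum.low (h : TwoSum I P Q u v) (hP : Low I P u v k) (hQ : Low I Q u v l) :
    Low I (P.union Q) u v (k + l) := by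
  obtain ⟨S, huS, hvS, hS⟩ := hP
  obtain ⟨T, huT, hvT, hT⟩ := hQ
  obtain ⟨Z, hZ1, hZ2⟩ := exists_combination (P := P) (Q := Q) S T (by
    rw [h.inter]
    rintro z (rfl | rfl) <;> simp [*])
  have hu := (mem_iff_of_inter_eq hZ1 h.fst_mem).2 huS
  have hv := (mem_iff_of_inter_eq hZ1 h.snd_mem).2 hvS
  refine ⟨Z, hu, hv, ?_⟩
  rw [h.bal_of_mem_mem hu hv, bal_congr hZ1, bal_congr hZ2]
  omega

theorem OneSum.cutEdge (h : OneSum I P Q w) (hP : CutEdge I P x w) (hx : x ∈ P.verts)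
    (hy : y ∈ Q.verts) : CutEdge I (P.union Q) x y := by
  obtain ⟨e, he, hinc, hl⟩ := hP
  refine ⟨e, Or.inl he, hinc, ?_⟩
  rw [del_union (Set.disjoint_left.1 h.disj he)]
  exact not_linked_union_of_inter_eq_singleton (h.left.del e) h.right h.inter hx hy hl

/-! ### Consequences of toughness -/

theorem TwoSum.tough_both (h : TwoSum I X E u v) (ht : Tough I (X.union E))
    (huS : u ∈ S) (hvS : v ∈ S) (huT : u ∈ T) (hvT : v ∈ T) :
    X.bal I S + E.bal I T + 4 ≤ 0 := by
  obtain ⟨Z, hZ1, hZ2⟩ := exists_combination (P := X) (Q := E) S T (by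
    rw [h.inter]
    rintro z (rfl | rfl) <;> simp [*])
  have hu := (mem_iff_of_inter_eq hZ1 h.fst_mem).2 huS
  have hv := (mem_iff_of_inter_eq hZ1 h.snd_mem).2 hvS
  have h1 := h.bal_of_mem_mem hu hv
  have h2 := (ht Z).2 (Set.nonempty_iff_ne_empty.1 ⟨u, hu, Or.inl h.fst_mem⟩)
  rw [bal_congr hZ1, bal_congr hZ2] at h1
  omega

theorem TwoSum.tough_snd (h : TwoSum I X E u v) (ht : Tough I (X.union E))
    (huS : u ∉ S) (hvS : v ∈ S) (huT : u ∉ T) (hvT : v ∈ T) :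
    X.bal I S + E.bal I T + 1 ≤ 0 := by
  obtain ⟨Z, hZ1, hZ2⟩ := exists_combination (P := X) (Q := E) S T (by
    rw [h.inter]
    rintro z (rfl | rfl) <;> simp [*])
  have hu := mt (mem_iff_of_inter_eq hZ1 h.fst_mem).1 huS
  have hv := (mem_iff_of_inter_eq hZ1 h.snd_mem).2 hvS
  have h1 := h.bal_of_notMem_mem hu hv
  have h2 := (ht Z).2 (Set.nonempty_iff_ne_empty.1 ⟨v, hv, Or.inl h.snd_mem⟩)
  rw [bal_congr hZ1, bal_congr hZ2] at h1
  omega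

/-- If no terminal is deleted and nothing of `X` is deleted, then `E` cannot contribute two
components. -/
theorem TwoSum.bal_env_le (h : TwoSum I X E u v) (ht : Tough I (X.union E))
    (hX : Base I X u v) (hE : E.Linked I ∅ u v) (huT : u ∉ T) (hvT : v ∉ T) :
    E.bal I T ≤ 1 := by
  obtain ⟨Z, hZ1, hZ2⟩ := exists_combination (P := X) (Q := E) ∅ T (by
    rw [h.inter]
    rintro z (rfl | rfl) <;> simp [*])
  have hu := mt (mem_iff_of_inter_eq hZ1 h.fst_mem).1 (Set.notMem_empty u)
  have hv := mt (mem_iff_of_inter_eq hZ1 h.snd_mem).1 (Set.notMem_empty v)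
  have h2 := hX.bal_empty
  rw [← bal_congr hZ1] at h2
  rw [← bal_congr hZ2]
  have h3 := (ht Z).1
  by_cases hl : E.Linked I Z u v
  · have h1 := h.bal_of_linked hu hv ((linked_congr hZ1).2 hX.linked) hl
    omega
  · have h1 := h.bal_of_not_linked_right hu hv hl
    have h4 := (ht Z).2 fun h0 => hl ((linked_congr (S' := ∅) (by
      rw [Set.empty_inter, ← Set.subset_empty_iff, ← h0]
      exact Set.inter_subset_inter_right _ Set.subset_union_right)).2 hE)
    by_contra hlt
    omega

/-- Otherwise `X` contributes at most 0 and `E` at most 1, while gluing takes off 2, so the total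
would be negative. -/
theorem TwoSum.linked_of_tight (h : TwoSum I X E u v) (ht : Tough I (X.union E))
    (hX : Base I X u v) (hp : Prof I X u v k) (hE : E.Linked I ∅ u v) (hu : u ∉ S) (hv : v ∉ S)
    (hS : 0 ≤ (X.union E).bal I S) : X.Linked I S u v := by
  by_contra hl
  have h1 := h.bal_of_not_linked hu hv hl
  have h2 := hp.sep S hu hv hl
  have h3 := h.bal_env_le ht hX hE hu hv
  omega

/-- Take the set that witnesses criticality of `e`. It avoids `u`, since otherwise deleting `e`
changes nothing. If it also avoided `v`, both sides would link the terminals before the deletion.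
Losing the bridge `e` then raises the balance of `X` by at most 1, and this gain is lost in gluing,
which now takes off 2 instead of 1. -/
theorem TwoSum.exists_tight_of_cutEdge (h : TwoSum I X E u v) (ht : Tough I (X.union E))
    (hX : Base I X u v) (hp : Prof I X u v k) (hE : E.Linked I ∅ u v)
    (hE' : ∀ S, u ∉ S → v ∉ S → 0 ≤ (X.union E).bal I S → E.Linked I S u v)
    (he : e ∈ X.edges) (hinc : I.Inc e u) (hcut : ¬ (X.del e).Linked I ∅ u v)
    (hcrit : Critical I (X.union E) e) :
    ∃ S, u ∉ S ∧ v ∈ S ∧ 0 ≤ (X.union E).bal I S ∧ 1 ≤ ((X.union E).del e).bal I S := by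
  obtain ⟨S, hS, hS'⟩ := hcrit
  have h1 := bal_del_le (hX.closed.union h.right) e S
  refine ⟨S, ?_, ?_, by omega, hS⟩
  · intro hu
    have h2 := bal_del_of_inc (P := X.union E) hu hinc
    have h3 := (ht S).2 (Set.nonempty_iff_ne_empty.1 ⟨u, hu, Or.inl hX.fst_mem⟩)
    omega
  · by_contra hv
    have hu : u ∉ S := by
      intro hu
      have h2 := bal_del_of_inc (P := X.union E) hu hinc
      have h3 := (ht S).2 (Set.nonempty_iff_ne_empty.1 ⟨u, hu, Or.inl hX.fst_mem⟩)
      omega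
    have hXl := h.linked_of_tight ht hX hp hE hu hv (by omega)
    have hEl := hE' S hu hv (by omega)
    have h2 := h.bal_of_linked hu hv hXl hEl
    have h3 := (h.del e).bal_of_not_linked hu hv fun hl => hcut (hl.anti hu hv)
    have h4 := bal_del_le hX.closed e S
    rw [del_union (Set.disjoint_left.1 h.disj he)] at hS hS'
    have h5 := ht S
    by_cases h0 : S ∩ (X.union E).verts = ∅
    · have h6 := hS' h0
      have h7 := h5.1
      omega
    · have h7 := h5.2 h0
      omega

/-! ### Rearranging three parts -/

theorem TwoSum.assoc (h : TwoSum I P Q u v) (h' : TwoSum I (P.union Q) R u v) :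
    TwoSum I P (Q.union R) u v where
  left := h.left
  right := h.right.union h'.right
  inter := by
    rw [verts_union, Set.inter_union_distrib_left, h.inter]
    refine Set.union_eq_left.2 ?_
    rw [← h'.inter]
    exact Set.inter_subset_inter_left _ Set.subset_union_left
  ne := h.ne
  disj := Set.disjoint_union_right.2 ⟨h.disj, h'.disj.mono_left Set.subset_union_left⟩

theorem OneSum.inter_right (h : OneSum I P Q w) (h' : TwoSum I (P.union Q) E x y)
    (hP : Base I P x w) (hQ : Base I Q w y) : P.verts ∩ E.verts = {x} := by
  have hy := h.symm.fst_notMem hQ.snd_mem hQ.ne.symm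
  have hxE : x ∈ E.verts := h'.symm.fst_mem
  ext z
  constructor
  · rintro ⟨hz, hz'⟩
    have : z ∈ (P.union Q).verts ∩ E.verts := ⟨Or.inl hz, hz'⟩
    rw [h'.inter] at this
    rcases this with rfl | rfl
    exacts [rfl, absurd hz hy]
  · rintro rfl
    exact ⟨hP.fst_mem, hxE⟩

theorem OneSum.twoSum (h : OneSum I P Q w) (h' : TwoSum I (P.union Q) E x y)
    (hP : Base I P x w) (hQ : Base I Q w y) : TwoSum I P (Q.union E) x w where
  left := h.left
  right := h.right.union h'.right
  inter := by
    rw [verts_union, Set.inter_union_distrib_left, h.inter, h.inter_right h' hP hQ, Set.union_comm]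
    rfl
  ne := hP.ne
  disj := Set.disjoint_union_right.2 ⟨h.disj, h'.disj.mono_left Set.subset_union_left⟩

theorem OneSum.oneSum_left (h : OneSum I P Q w) (h' : TwoSum I (P.union Q) E x y)
    (hP : Base I P x w) (hQ : Base I Q w y) : OneSum I P E x where
  left := h.left
  right := h'.right
  inter := h.inter_right h' hP hQ
  disj := h'.disj.mono_left Set.subset_union_left

end GraphPart

namespace GraphPart

variable {α β : Type*} {I : Graph α β} {P Q R X Y E G L : GraphPart α β} {S T : Set α}
  {u v w x y : α} {e : β} {k l : ℤ}

/-! ### Parallel joins in a tough graph -/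

/-- The rest of the graph as seen from `P` is `Q ∪ E`. It links the terminals through `Q`, even
after removal of a tight set avoiding them, so nothing is asked of the connectivity of `E`. -/
theorem TwoSum.exists_tight_of_par (h : TwoSum I P Q u v) (h' : TwoSum I (P.union Q) E u v)
    (ht : Tough I ((P.union Q).union E)) (hP : Base I P u v) (hQ : Base I Q u v)
    (hp : Prof I P u v k) (hq : Prof I Q u v l) (hcut : CutEdge I P u v)
    (hcrit : ∀ e ∈ P.edges, Critical I ((P.union Q).union E) e) :
    ∃ e ∈ P.edges, ∃ S, u ∉ S ∧ v ∈ S ∧ 0 ≤ ((P.union Q).union E).bal I S ∧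
      1 ≤ (((P.union Q).union E).del e).bal I S := by
  obtain ⟨e, he, hinc, hl⟩ := hcut
  have hQP : TwoSum I (Q.union P) E u v := by rwa [union_comm]
  have hG : Q.union (P.union E) = (P.union Q).union E := by
    rw [← union_assoc, union_comm Q P]
  have hcr := hcrit e he
  rw [union_assoc] at ht hcr ⊢
  refine ⟨e, he, (h.assoc h').exists_tight_of_cutEdge ht hP hp
    (hQ.linked.union_left hQ.fst_mem hQ.snd_mem) (fun S hu hv hS => ?_) he hinc hl hcr⟩
  rw [← union_assoc, ← hG] at ht hS
  exact ((h.symm.assoc hQP).linked_of_tight ht hQ hq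
    (hP.linked.union_left hP.fst_mem hP.snd_mem) hu hv hS).union_left hQ.fst_mem hQ.snd_mem

theorem TwoSum.half_of_par (h : TwoSum I P Q u v) (h' : TwoSum I (P.union Q) E u v)
    (ht : Tough I ((P.union Q).union E)) (hP : Base I P u v) (hQ : Base I Q u v)
    (hp : Prof I P u v k) (hq : Prof I Q u v l)
    (hside : CutEdge I P u v ∨ Half I ((P.union Q).union E) u v)
    (hcrit : ∀ e ∈ P.edges, Critical I ((P.union Q).union E) e) :
    Half I ((P.union Q).union E) u v := by
  rcases hside with hcut | hhalf
  · obtain ⟨e, -, S, hu, hv, hS, -⟩ := h.exists_tight_of_par h' ht hP hQ hp hq hcut hcrit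
    exact ⟨S, hu, hv, hS⟩
  · exact hhalf

/-- The tight set obtained from the cut edge contains `v`, an end of that edge, so deleting the edge
cannot raise its balance above 0. -/
theorem TwoSum.false_of_edge (h : TwoSum I P Q u v) (h' : TwoSum I (P.union Q) E u v)
    (ht : Tough I ((P.union Q).union E)) (hP : Base I P u v) (hQ : Base I Q u v)
    (hp : Prof I P u v k) (hq : Prof I Q u v l) (hcut : CutEdge I P u v)
    (hcrit : ∀ e ∈ P.edges, Critical I ((P.union Q).union E) e)
    (hedge : ∀ e ∈ P.edges, I.Inc e v) : False := by
  obtain ⟨e, he, S, -, hv, -, hS⟩ := h.exists_tight_of_par h' ht hP hQ hp hq hcut hcrit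
  have h1 := bal_del_of_inc (P := (P.union Q).union E) hv (hedge e he)
  have h2 := (ht S).2 (Set.nonempty_iff_ne_empty.1 ⟨v, hv, Or.inl (Or.inl hP.snd_mem)⟩)
  omega

theorem TwoSum.bal_env_of_half (h : TwoSum I X E u v) (hp : Prof I X u v k)
    (hh : Half I (X.union E) u v) : ∃ S, u ∉ S ∧ v ∈ S ∧ 0 ≤ E.bal I S := by
  obtain ⟨S, hu, hv, hS⟩ := hh
  have h1 := h.bal_of_notMem_mem hu hv
  have h2 := hp.snd S hu hv
  exact ⟨S, hu, hv, by omega⟩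

/-- The tight set gives `E` a balance of at least 0 with `v` but not `u` deleted, and deleting `u`
too costs at most 3. Against the extremal set of `X` this yields `(k - 4) - 3 + 4 ≤ 0`. -/
theorem TwoSum.le_three (h : TwoSum I X E u v) (ht : Tough I (X.union E))
    (hp : Prof I X u v k) (hl : Low I X u v k) (hh : Half I (X.union E) u v) : k ≤ 3 := by
  obtain ⟨S, hu, hv, hS⟩ := h.bal_env_of_half hp hh
  obtain ⟨T, huT, hvT, hT⟩ := hl
  have h3 := bal_insert_ge h.right u S
  have h4 := h.tough_both ht huT hvT (Set.mem_insert u S) (Set.mem_insert_of_mem u hv)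
  omega

/-! ### Series joins in a tough graph -/

/-- Tightness forces a balance of at least 0 on `Q ∪ E`. If `y` were kept, it would be at most `-1 +
1 - 1`. So `y` is deleted, and the same set is a tight set for `x`, `y`. Then `E` contributes at
most 0, and `(l - 4) + 0 + 2 ≥ 0` remains. -/
theorem OneSum.half_of_ser (h : OneSum I P Q w) (h' : TwoSum I (P.union Q) E x y)
    (ht : Tough I ((P.union Q).union E)) (hE : E.Linked I ∅ x y)
    (hP : Base I P x w) (hQ : Base I Q w y) (hp : Prof I P x w k) (hq : Prof I Q w y l)
    (hh : Half I ((P.union Q).union E) x w) : Half I ((P.union Q).union E) x y ∧ 2 ≤ l := by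
  obtain ⟨S, hx, hw, hS⟩ := hh
  have hX := h.base hP hQ
  have h1 := hp.snd S hx hw
  have hQP : OneSum I Q E y := h.symm.oneSum_left (by rw [union_comm]; exact h'.swap)
    hQ.swap hP.swap
  have h2 := (h.twoSum h' hP hQ).bal_of_notMem_mem hx hw
  have h3 := hS
  rw [union_assoc] at h3
  have hy : y ∈ S := by
    by_contra hy
    have h4 := hQP.bal_of_notMem hy
    have h5 := hq.fst S hw hy
    have h6 := h'.bal_env_le ht hX hE hx hy
    omega
  refine ⟨⟨S, hx, hy, hS⟩, ?_⟩
  have h4 := hQP.bal_of_mem hy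
  have h5 := hq.both S hw hy
  -- Testing `E` against the deletion of `y` alone from the series join, where the balance is at
  -- least -1, bounds the contribution of `E` by 0.
  have h6 := h'.tough_snd ht (S := {y}) (T := S) (by simpa using hX.ne) (by simp) hx hy
  have h7 := hX.bal_snd
  omega

/-- The tight set `S` gives `Q ∪ E` a balance of at least 0. If `y ∈ S`, then `hlow'` bounds the
balance of `E` by -2, which is too small. If `y ∉ S`, then `E` has balance at least 0, and a
modified set on `Q ∪ E` is played off against the extremal set of `P`. -/
theorem OneSum.le_two_of_ser (h : OneSum I P Q w) (h' : TwoSum I (P.union Q) E x y)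
    (ht : Tough I ((P.union Q).union E))
    (hP : Base I P x w) (hQ : Base I Q w y) (hp : Prof I P x w k) (hq : Prof I Q w y l)
    (hlow : Low I P x w k) (hlow' : Low I (P.union Q) x y 2)
    (hh : Half I ((P.union Q).union E) w x) : k ≤ 2 := by
  obtain ⟨S, hw, hx, hS⟩ := hh
  have h1 := hp.fst S hx hw
  have hQP : OneSum I Q E y := h.symm.oneSum_left (by rw [union_comm]; exact h'.swap)
    hQ.swap hP.swap
  have hPE := h.twoSum h' hP hQ
  have h2 := hPE.bal_of_mem_notMem hx hw
  rw [union_assoc] at hS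
  by_cases hy : y ∈ S
  · have h4 := hQP.bal_of_mem hy
    have h5 := hq.snd S hw hy
    obtain ⟨T, hxT, hyT, hT⟩ := hlow'
    have h6 := h'.tough_both ht hxT hyT hx hy
    omega
  · have h4 := hQP.bal_of_notMem hy
    have h5 := hq.none S hw hy
    have hwE : w ∉ E.verts := by
      intro hwE
      have : w ∈ P.verts ∩ E.verts := ⟨hP.snd_mem, hwE⟩
      rw [h.inter_right h' hP hQ] at this
      exact hP.ne this.symm
    have hxQ := h.fst_notMem hP.fst_mem hP.ne
    -- On `Q` only `w` is deleted, on `E` the set `S` is kept. This deletes both `x` and `w` and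
    -- leaves `Q ∪ E` a balance of at least `-1 + 0 - 1`, so that `(k - 4) - 2 + 4 ≤ 0`.
    obtain ⟨Z, hZ1, hZ2⟩ := exists_combination (P := Q) (Q := E) {w} S (by
      rw [hQP.inter]
      rintro z rfl
      simp [hQ.ne.symm, hy])
    have hwZ : w ∈ Z := (mem_iff_of_inter_eq hZ1 hQ.fst_mem).2 rfl
    have hyZ : y ∉ Z := mt (mem_iff_of_inter_eq hZ1 hQ.snd_mem).1 hQ.ne.symm
    have hxZ : x ∈ Z := (mem_iff_of_inter_eq hZ2 h'.symm.fst_mem).2 hx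
    have h6 := hQP.bal_of_notMem hyZ
    rw [bal_congr hZ1, bal_congr hZ2] at h6
    have h7 := hQ.bal_fst
    obtain ⟨T, hxT, hwT, hT⟩ := hlow
    rw [union_assoc] at ht
    have h8 := hPE.tough_both ht hxT hwT hxZ hwZ
    omega

end GraphPart

/-! ### Binary series-parallel trees -/

/-- Binary trees for series-parallel constructions. -/
inductive BinTree : Type
  | leaf : BinTree
  | ser (a b : BinTree) : BinTree
  | par (a b : BinTree) : BinTree

namespace BinTree

open GraphPart

/-- The part `P` of `I` with terminals `u` and `v` is constructed according to a binary tree. -/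
inductive Builds {α β : Type*} (I : Graph α β) : BinTree → GraphPart α β → α → α → Prop
  | leaf (e : β) (u v : α) (huv : u ≠ v) (he : I.IsLink e u v) : Builds I leaf ⟨{u, v}, {e}⟩ u v
  | ser (a b : BinTree) (P Q : GraphPart α β) (u w v : α) (hP : Builds I a P u w)
      (hQ : Builds I b Q w v) (h : OneSum I P Q w) : Builds I (ser a b) (P.union Q) u v
  | par (a b : BinTree) (P Q : GraphPart α β) (u v : α) (hP : Builds I a P u v)
      (hQ : Builds I b Q u v) (h : TwoSum I P Q u v) : Builds I (par a b) (P.union Q) u v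

/-- The tree describes a path. -/
def IsPath : BinTree → Prop
  | leaf => True
  | ser a b => a.IsPath ∧ b.IsPath
  | par _ _ => False

/-- The tree describes a series join of pairs of parallel paths. -/
def IsChain : BinTree → Prop
  | leaf => False
  | ser a b => a.IsChain ∧ b.IsChain
  | par a b => (a.IsPath ∧ a ≠ leaf) ∧ b.IsPath ∧ b ≠ leaf

/-- The tree describes a parallel join of a path and a chain. -/
def IsTriple : BinTree → Prop
  | leaf => False
  | ser _ _ => False
  | par a b => (a.IsPath ∧ a ≠ leaf) ∧ b.IsChain ∨ a.IsChain ∧ b.IsPath ∧ b ≠ leaf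

variable {α β : Type*} {I : Graph α β} {P Q R X Y E G L : GraphPart α β} {S T : Set α}
  {u v w x y : α} {e : β} {b : BinTree}

theorem closed_leaf (he : I.IsLink e u v) : Closed I (⟨{u, v}, {e}⟩ : GraphPart α β) where
  finite := by simp
  mem := by
    rintro e' rfl x y hl
    rcases he.eq_and_eq_or_eq_and_eq hl with ⟨rfl, rfl⟩ | ⟨rfl, rfl⟩ <;> simp

theorem linked_leaf (he : I.IsLink e u v) (hu : u ∉ S) (hv : v ∉ S) :
    Linked I (⟨{u, v}, {e}⟩ : GraphPart α β) S u v :=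
  fun _ hf => hf.2 e rfl u v he ⟨by simp, hu⟩ ⟨by simp, hv⟩

theorem bal_leaf_both (hu : u ∈ S) (hv : v ∈ S) (huv : u ≠ v) :
    (⟨{u, v}, {e}⟩ : GraphPart α β).bal I S = -4 := by
  have h1 : (⟨{u, v}, {e}⟩ : GraphPart α β).comps I S = 0 := by
    have h0 : ({u, v} : Set α) \ S = ∅ :=
      Set.sdiff_eq_empty.2 (by simp [Set.insert_subset_iff, hu, hv])
    have : I.locConst (({u, v} : Set α) \ S) {e} = ⊥ := by
      rw [eq_bot_iff, h0]
      rintro f ⟨hf, -⟩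
      have : f = 0 := by
        ext x
        exact hf x (Set.notMem_empty x)
      exact this
    rw [comps, this, finrank_bot]
  have h2 : S ∩ {u, v} = {u, v} :=
    Set.inter_eq_right.2 (by simp [Set.insert_subset_iff, hu, hv])
  simp [bal, h1, h2, Set.ncard_pair huv]

theorem bal_leaf_none (he : I.IsLink e u v) (hu : u ∉ S) (hv : v ∉ S) :
    (⟨{u, v}, {e}⟩ : GraphPart α β).bal I S = 1 := by
  have h1 : (⟨{u, v}, {e}⟩ : GraphPart α β).comps I S = 1 := by
    refine finrank_eq_one (⟨_, Graph.indicator_mem_locConst (({u, v} : Set α) \ S) {e} 1⟩ :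
      I.locConst (({u, v} : Set α) \ S) {e}) ?_ ?_
    · intro h
      have := congrFun (congrArg Subtype.val h) u
      simp [hu] at this
    · rintro ⟨f, hf, hf'⟩
      refine ⟨f u, ?_⟩
      ext x
      have hfv := hf' e rfl u v he ⟨by simp, hu⟩ ⟨by simp, hv⟩
      by_cases hx : x ∈ ({u, v} : Set α) \ S
      · rcases hx.1 with rfl | rfl
        · simp [hu]
        · simp [hv, hfv]
      · have := hf x hx
        simp [Set.indicator_of_notMem hx, this]
  simp [bal, h1, pair_inter_of_notMem hu hv]

theorem bal_leaf_one (hu : u ∈ S) (hv : v ∉ S) :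
    (⟨{u, v}, {e}⟩ : GraphPart α β).bal I S = -1 := by
  have hd : ({u, v} : Set α) \ S = {v} := by
    ext z
    simp only [Set.mem_sdiff, Set.mem_insert_iff, Set.mem_singleton_iff]
    constructor
    · rintro ⟨rfl | rfl, hz⟩
      exacts [absurd hu hz, rfl]
    · rintro rfl
      exact ⟨Or.inr rfl, hv⟩
  have hi : S ∩ {u, v} = {u} := by
    ext z
    simp only [Set.mem_inter_iff, Set.mem_insert_iff, Set.mem_singleton_iff]
    constructor
    · rintro ⟨hz, rfl | rfl⟩
      exacts [rfl, absurd hz hv]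
    · rintro rfl
      exact ⟨hu, Or.inl rfl⟩
  have h1 : (⟨{u, v}, {e}⟩ : GraphPart α β).comps I S = 1 := by
    change Module.finrank ℚ (I.locConst (({u, v} : Set α) \ S) {e}) = 1
    rw [hd]
    refine finrank_eq_one (⟨_, Graph.indicator_mem_locConst ({v} : Set α) {e} 1⟩ :
      I.locConst ({v} : Set α) {e}) ?_ ?_
    · intro h
      have := congrFun (congrArg Subtype.val h) v
      simp at this
    · rintro ⟨f, hf, hf'⟩
      refine ⟨f v, ?_⟩
      ext x
      by_cases hx : x = v
      · simp [hx]
      · simp [hx, hf x hx]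
  simp [bal, h1, hi]

theorem leaf_comm : (⟨{u, v}, {e}⟩ : GraphPart α β) = ⟨{v, u}, {e}⟩ := by
  rw [Set.pair_comm]

theorem base_leaf (he : I.IsLink e u v) (huv : u ≠ v) : Base I ⟨{u, v}, {e}⟩ u v where
  closed := closed_leaf he
  fst_mem := by simp
  snd_mem := by simp
  ne := huv
  bal_empty := (bal_leaf_none he (by simp) (by simp)).ge
  bal_fst := (bal_leaf_one (by simp) (by simpa using huv.symm)).ge
  bal_snd := by
    rw [leaf_comm]
    exact (bal_leaf_one (by simp) (by simpa using huv)).ge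
  linked := linked_leaf he (by simp) (by simp)

theorem prof_leaf (he : I.IsLink e u v) (huv : u ≠ v) : Prof I ⟨{u, v}, {e}⟩ u v 1 where
  both S hu hv := by rw [bal_leaf_both hu hv huv]; omega
  fst S hu hv := (bal_leaf_one hu hv).le
  snd S hu hv := by
    rw [leaf_comm]
    exact (bal_leaf_one hv hu).le
  none S hu hv := (bal_leaf_none he hu hv).le
  sep S hu hv hl := absurd (linked_leaf he hu hv) hl

theorem cutEdge_leaf (he : I.IsLink e u v) (huv : u ≠ v) :
    CutEdge I ⟨{u, v}, {e}⟩ u v := by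
  classical
  refine ⟨e, rfl, he.inc_left, fun hl => ?_⟩
  have := hl (Pi.single u 1) ⟨fun x hx => ?_, fun e' he' => absurd he'.1 he'.2⟩
  · simp [huv.symm] at this
  · have : x ≠ u := by
      rintro rfl
      exact hx ⟨Or.inl rfl, Set.notMem_empty x⟩
    simp [this]

theorem Builds.base (h : Builds I b P u v) : Base I P u v := by
  induction h with
  | leaf e u v huv he => exact base_leaf he huv
  | ser a b P Q u w v _ _ h hP hQ => exact h.base hP hQ
  | par a b P Q u v _ _ h hP hQ => exact h.base hP hQ

theorem Builds.inc_of_leaf (h : Builds I BinTree.leaf P u v) (e : β) (he : e ∈ P.edges) :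
    I.Inc e u ∧ I.Inc e v := by
  cases h with
  | leaf e' u v huv hl =>
    rw [Set.mem_singleton_iff.1 he]
    exact ⟨hl.inc_left, hl.inc_right⟩

/-- What is known about a part that is constructed according to `b` inside a tough graph `G`. -/
inductive Summary (I : Graph α β) (G : GraphPart α β) (b : BinTree) (P : GraphPart α β) (u v : α) :
    Prop
  | path (h : b.IsPath) (hp : Prof I P u v 1) (hu : CutEdge I P u v) (hv : CutEdge I P v u)
      (hl : b ≠ leaf → Low I P u v 1)
  | chain (h : b.IsChain) (hp : Prof I P u v 2) (hl : Low I P u v 2) (hu : Half I G u v)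
      (hv : Half I G v u)
  | triple (h : b.IsTriple) (hp : Prof I P u v 3) (hl : Low I P u v 3) (hu : Half I G u v)
      (hv : Half I G v u)

theorem Summary.exists_prof (h : Summary I G b P u v) : ∃ k : ℤ, 1 ≤ k ∧ Prof I P u v k := by
  rcases h with ⟨_, hp, _⟩ | ⟨_, hp, _⟩ | ⟨_, hp, _⟩
  exacts [⟨1, by norm_num, hp⟩, ⟨2, by norm_num, hp⟩, ⟨3, by norm_num, hp⟩]

end BinTree

namespace BinTree
open GraphPart

variable {α β : Type*} {I : Graph α β} {P Q R X Y E G L : GraphPart α β} {S T : Set α}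
  {u v w x y : α} {e : β} {a b : BinTree}

theorem Summary.side_fst (h : Summary I G b P u v) : CutEdge I P u v ∨ Half I G u v := by
  rcases h with ⟨_, _, h, _⟩ | ⟨_, _, _, h, _⟩ | ⟨_, _, _, h, _⟩
  exacts [Or.inl h, Or.inr h, Or.inr h]

theorem Summary.side_snd (h : Summary I G b P u v) : CutEdge I P v u ∨ Half I G v u := by
  rcases h with ⟨_, _, _, h, _⟩ | ⟨_, _, _, _, h⟩ | ⟨_, _, _, _, h⟩
  exacts [Or.inl h, Or.inr h, Or.inr h]

theorem Summary.ne_leaf_of_par (h : TwoSum I P Q u v) (h' : TwoSum I (P.union Q) E u v)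
    (ht : Tough I ((P.union Q).union E)) (hP : Builds I a P u v) (hQ : Base I Q u v)
    (ha : Summary I ((P.union Q).union E) a P u v) {l : ℤ} (hq : Prof I Q u v l)
    (hcrit : ∀ e ∈ P.edges, Critical I ((P.union Q).union E) e) : a ≠ leaf := by
  rintro rfl
  rcases ha with ⟨_, hp, hcut, _⟩ | ⟨hc, _⟩ | ⟨hc, _⟩
  · exact h.false_of_edge h' ht hP.base hQ hp hq hcut hcrit fun e he => (hP.inc_of_leaf e he).2
  · exact hc
  · exact hc

/-- The parallel step. The environment `E` may be disconnected. -/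
theorem Summary.par (h : TwoSum I P Q u v) (h' : TwoSum I (P.union Q) E u v)
    (ht : Tough I ((P.union Q).union E)) (hP : Builds I a P u v) (hQ : Builds I b Q u v)
    (hcrit : ∀ e ∈ (P.union Q).edges, Critical I ((P.union Q).union E) e)
    (ha : Summary I ((P.union Q).union E) a P u v)
    (hb : Summary I ((P.union Q).union E) b Q u v) :
    Summary I ((P.union Q).union E) (BinTree.par a b) (P.union Q) u v := by
  have hQP : TwoSum I (Q.union P) E u v := by rwa [union_comm]
  have hcomm : (Q.union P).union E = (P.union Q).union E := by rw [union_comm Q P]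
  have hcritP : ∀ e ∈ P.edges, Critical I ((P.union Q).union E) e :=
    fun e he => hcrit e (Or.inl he)
  have hcritQ : ∀ e ∈ Q.edges, Critical I ((P.union Q).union E) e :=
    fun e he => hcrit e (Or.inr he)
  obtain ⟨k, hk, hp⟩ := ha.exists_prof
  obtain ⟨l, hl, hq⟩ := hb.exists_prof
  have hane := ha.ne_leaf_of_par h h' ht hP hQ.base hq hcritP
  have hbne : b ≠ leaf := by
    rw [← hcomm] at ht hb hcritQ
    exact hb.ne_leaf_of_par h.symm hQP ht hQ hP.base hp hcritQ
  have hu := h.half_of_par h' ht hP.base hQ.base hp hq ha.side_fst hcritP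
  have hv := h.swap.half_of_par h'.swap ht hP.base.swap hQ.base.swap hp.swap hq.swap ha.side_snd hcritP
  have key : ∀ k l : ℤ, Prof I P u v k → Low I P u v k → Prof I Q u v l → Low I Q u v l →
      k + l ≤ 3 := fun k l hp hlp hq hlq => h'.le_three ht (h.prof hp hq) (h.low hlp hlq) hu
  -- Of the nine pairs of types only `1 + 1`, `1 + 2` and `2 + 1` respect the bound 3.
  rcases ha with ⟨pa, hp, -, -, hlp⟩ | ⟨pa, hp, hlp, -, -⟩ | ⟨pa, hp, hlp, -, -⟩ <;>
    rcases hb with ⟨pb, hq, -, -, hlq⟩ | ⟨pb, hq, hlq, -, -⟩ | ⟨pb, hq, hlq, -, -⟩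
  · exact .chain ⟨⟨pa, hane⟩, pb, hbne⟩ (h.prof hp hq) (h.low (hlp hane) (hlq hbne)) hu hv
  · exact .triple (Or.inl ⟨⟨pa, hane⟩, pb⟩) (h.prof hp hq) (h.low (hlp hane) hlq) hu hv
  · exact absurd (key _ _ hp (hlp hane) hq hlq) (by norm_num)
  · exact .triple (Or.inr ⟨pa, pb, hbne⟩) (h.prof hp hq) (h.low hlp (hlq hbne)) hu hv
  · exact absurd (key _ _ hp hlp hq hlq) (by norm_num)
  · exact absurd (key _ _ hp hlp hq hlq) (by norm_num)
  · exact absurd (key _ _ hp hlp hq (hlq hbne)) (by norm_num)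
  · exact absurd (key _ _ hp hlp hq hlq) (by norm_num)
  · exact absurd (key _ _ hp hlp hq hlq) (by norm_num)

/-- The series step inside a connected environment `E`. -/
theorem Summary.ser (h : OneSum I P Q w) (h' : TwoSum I (P.union Q) E x y)
    (ht : Tough I ((P.union Q).union E)) (hE : E.Linked I ∅ x y)
    (hP : Base I P x w) (hQ : Base I Q w y)
    (ha : Summary I ((P.union Q).union E) a P x w)
    (hb : Summary I ((P.union Q).union E) b Q w y) :
    Summary I ((P.union Q).union E) (BinTree.ser a b) (P.union Q) x y := by
  have hQP : TwoSum I (Q.union P) E y x := by rw [union_comm]; exact h'.swap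
  have hcomm : (Q.union P).union E = (P.union Q).union E := by rw [union_comm Q P]
  have left : ∀ k l : ℤ, Prof I P x w k → Prof I Q w y l → Half I ((P.union Q).union E) x w →
      Half I ((P.union Q).union E) x y ∧ 2 ≤ l :=
    fun k l hp hq hh => h.half_of_ser h' ht hE hP hQ hp hq hh
  have right : ∀ k l : ℤ, Prof I P x w k → Prof I Q w y l → Half I ((P.union Q).union E) y w →
      Half I ((P.union Q).union E) y x ∧ 2 ≤ k := by
    intro k l hp hq hh
    rw [← hcomm] at ht hh ⊢
    exact h.symm.half_of_ser hQP ht hE.symm hQ.swap hP.swap hq.swap hp.swap hh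
  have left2 : ∀ k l : ℤ, Prof I P x w k → Prof I Q w y l → Low I P x w k →
      Half I ((P.union Q).union E) w x → Low I (P.union Q) x y 2 → k ≤ 2 :=
    fun k l hp hq hlp hh hlow => h.le_two_of_ser h' ht hP hQ hp hq hlp hlow hh
  have right2 : ∀ k l : ℤ, Prof I P x w k → Prof I Q w y l → Low I Q w y l →
      Half I ((P.union Q).union E) w y → Low I (P.union Q) x y 2 → l ≤ 2 := by
    intro k l hp hq hlq hh hlow
    rw [union_comm P Q] at hlow
    rw [← hcomm] at ht hh
    exact h.symm.le_two_of_ser hQP ht hQ.swap hP.swap hq.swap hp.swap hlq.swap hlow.swap hh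
  have low2 : ∀ k l : ℤ, 4 ≤ k + l → Low I P x w k → Low I Q w y l →
      Low I (P.union Q) x y 2 := by
    intro k l hkl hlp hlq
    obtain ⟨S, hx, hy, hS⟩ := h.low hlp hlq hP.fst_mem hQ.snd_mem
    exact ⟨S, hx, hy, by omega⟩
  -- Two paths or two chains can be joined. A path beside another type contradicts `left` or
  -- `right`, and a triple beside a non-path contradicts `left2` or `right2`.
  rcases ha with ⟨pa, hp, ca, -, -⟩ | ⟨pa, hp, hlp, ha, ha'⟩ | ⟨pa, hp, hlp, ha, ha'⟩ <;>
    rcases hb with ⟨pb, hq, -, cb, -⟩ | ⟨pb, hq, hlq, hb, hb'⟩ | ⟨pb, hq, hlq, hb, hb'⟩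
  · refine .path ⟨pa, pb⟩ (h.prof hp hq (by norm_num) (by norm_num) hP.fst_mem hP.snd_mem
      hQ.fst_mem hQ.snd_mem) (h.cutEdge ca hP.fst_mem hQ.snd_mem) ?_
      fun _ => h.low_one hP hQ
    rw [union_comm]
    exact h.symm.cutEdge cb hQ.snd_mem hP.fst_mem
  · exact absurd (right _ _ hp hq hb').2 (by norm_num)
  · exact absurd (right _ _ hp hq hb').2 (by norm_num)
  · exact absurd (left _ _ hp hq ha).2 (by norm_num)
  · exact .chain ⟨pa, pb⟩ (h.prof hp hq (by norm_num) (by norm_num) hP.fst_mem hP.snd_mem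
      hQ.fst_mem hQ.snd_mem) (h.low hlp hlq hP.fst_mem hQ.snd_mem) (left _ _ hp hq ha).1
      (right _ _ hp hq hb').1
  · exact absurd (right2 _ _ hp hq hlq hb
      (low2 _ _ (by norm_num) hlp hlq)) (by norm_num)
  · exact absurd (left _ _ hp hq ha).2 (by norm_num)
  · exact absurd (left2 _ _ hp hq hlp ha' (low2 _ _ (by norm_num) hlp hlq)) (by norm_num)
  · exact absurd (left2 _ _ hp hq hlp ha' (low2 _ _ (by norm_num) hlp hlq)) (by norm_num)

/-- The environment is generalized in the induction. For a child of a parallel node it is connected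
by the sibling, for a child of a series node by the sibling together with `E`. -/
theorem Builds.summary (h : Builds I b P u v) (hG : P.union E = G) (hPE : TwoSum I P E u v)
    (ht : Tough I G) (hE : E.Linked I ∅ u v) (hcrit : ∀ e ∈ P.edges, Critical I G e) :
    Summary I G b P u v := by
  induction h generalizing E with
  | leaf e u v huv he =>
    refine .path trivial (prof_leaf he huv) (cutEdge_leaf he huv) ?_ fun h => absurd rfl h
    rw [leaf_comm]
    exact cutEdge_leaf he.symm huv.symm
  | ser a b P Q x w y hP hQ h ihP ihQ =>
    have h1 := h.twoSum hPE hP.base hQ.base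
    have hQP : TwoSum I (Q.union P) E y x := by rw [union_comm]; exact hPE.swap
    have h2 := (h.symm.twoSum hQP hQ.base.swap hP.base.swap).swap
    have hx : x ∈ E.verts := hPE.symm.fst_mem
    have hy : y ∈ E.verts := hPE.symm.snd_mem
    have ha := ihP (E := Q.union E) (by rw [← union_assoc, hG]) h1
      ((hE.union_right hx hy).trans
        (hQ.base.linked.symm.union_left hQ.base.snd_mem hQ.base.fst_mem))
      fun e he => hcrit e (Or.inl he)
    have hb := ihQ (E := P.union E) (by rw [← union_assoc, union_comm Q P, hG]) h2
      ((hP.base.linked.symm.union_left hP.base.snd_mem hP.base.fst_mem).trans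
        (hE.union_right hx hy))
      fun e he => hcrit e (Or.inr he)
    subst hG
    exact Summary.ser h hPE ht hE hP.base hQ.base ha hb
  | par a b P Q u v hP hQ h ihP ihQ =>
    have hQP : TwoSum I (Q.union P) E u v := by rwa [union_comm]
    have ha := ihP (E := Q.union E) (by rw [← union_assoc, hG]) (h.assoc hPE)
      (hQ.base.linked.union_left hQ.base.fst_mem hQ.base.snd_mem)
      fun e he => hcrit e (Or.inl he)
    have hb := ihQ (E := P.union E) (by rw [← union_assoc, union_comm Q P, hG]) (h.symm.assoc hQP)
      (hP.base.linked.union_left hP.base.fst_mem hP.base.snd_mem)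
      fun e he => hcrit e (Or.inr he)
    subst hG
    exact Summary.par h hPE ht hP hQ hcrit ha hb

/-! ### The series root -/

/-- `P` has `L` attached to its first terminal and `R` to its second one. -/
structure Between (I : Graph α β) (L P R : GraphPart α β) (u v : α) : Prop where
  left : OneSum I P L u
  right : OneSum I P R v
  inter : L.verts ∩ R.verts = ∅
  disj : Disjoint L.edges R.edges

theorem Between.swap (h : Between I L P R u v) : Between I R P L v u :=
  ⟨h.right, h.left, by rw [Set.inter_comm, h.inter], h.disj.symm⟩

theorem Between.twoSum (h : Between I L P R u v) (huv : u ≠ v) : TwoSum I P (L.union R) u v where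
  left := h.left.left
  right := h.left.right.union h.right.right
  inter := by
    rw [verts_union, Set.inter_union_distrib_left, h.left.inter, h.right.inter]
    rfl
  ne := huv
  disj := Set.disjoint_union_right.2 ⟨h.left.disj, h.right.disj⟩

theorem Between.fst (h : Between I L (P.union Q) R x y) (hPQ : OneSum I P Q w) (hP : Base I P x w)
    (hQ : Base I Q w y) : Between I L P (Q.union R) x w where
  left := ⟨hPQ.left, h.left.right, by
    refine subset_antisymm ?_ ?_
    · rw [← h.left.inter]
      exact Set.inter_subset_inter_left _ Set.subset_union_left
    · rintro _ rfl
      exact ⟨hP.fst_mem, h.left.mem_right⟩, h.left.disj.mono_left Set.subset_union_left⟩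
  right := ⟨hPQ.left, hPQ.right.union h.right.right, by
    rw [verts_union, Set.inter_union_distrib_left, hPQ.inter]
    refine Set.union_eq_left.2 ?_
    rintro z ⟨hz, hz'⟩
    have : z ∈ (P.union Q).verts ∩ R.verts := ⟨Or.inl hz, hz'⟩
    rw [h.right.inter] at this
    subst this
    exact absurd hz (hPQ.symm.fst_notMem hQ.snd_mem hQ.ne.symm),
    Set.disjoint_union_right.2 ⟨hPQ.disj, h.right.disj.mono_left Set.subset_union_left⟩⟩
  inter := by
    rw [verts_union, Set.inter_union_distrib_left, h.inter, Set.union_empty]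
    rw [← Set.disjoint_iff_inter_eq_empty, Set.disjoint_left]
    intro z hz hz'
    have : z ∈ (P.union Q).verts ∩ L.verts := ⟨Or.inr hz', hz⟩
    rw [h.left.inter] at this
    subst this
    exact hPQ.fst_notMem hP.fst_mem hP.ne hz'
  disj := Set.disjoint_union_right.2
    ⟨(h.left.disj.mono_left Set.subset_union_right).symm, h.disj⟩

/-- With nothing deleted outside `L`, the rest adds at least one component and gluing at `u` takes
one off, so a larger balance of `L` would be one of the whole graph. -/
theorem Between.bal_left_le (h : Between I L P R u v) (huv : u ≠ v)
    (ht : Tough I (P.union (L.union R))) (hu : u ∉ S) : L.bal I S ≤ 1 := by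
  have hPR := h.left.left.union h.right.right
  have huR : u ∉ R.verts := h.right.fst_notMem h.left.mem_left huv
  have hsum : OneSum I L (P.union R) u := by
    refine ⟨h.left.right, hPR, ?_, Set.disjoint_union_right.2 ⟨h.left.disj.symm, h.disj⟩⟩
    rw [verts_union, Set.inter_union_distrib_left, h.inter, Set.union_empty, Set.inter_comm,
      h.left.inter]
  have hG : L.union (P.union R) = P.union (L.union R) := by
    rw [← union_assoc, union_comm L P, union_assoc]
  obtain ⟨Z, hZ1, hZ2⟩ := exists_combination (P := L) (Q := P.union R) S ∅ (by
    rw [hsum.inter]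
    rintro z rfl
    simp [hu])
  have h1 := hsum.bal_of_notMem (mt (mem_iff_of_inter_eq hZ1 h.left.mem_right).1 hu)
  have h2 := (ht Z).1
  rw [hG] at h1
  rw [bal_congr hZ1] at h1
  have h3 := one_le_bal_of_inter_eq_empty hPR (Or.inl h.left.mem_left) (by simpa using hZ2)
  omega

/-- The environment has balance at least 0 on the tight set, and `L` accounts for at most 1 of it.
-/
theorem Between.exists_of_half (h : Between I L P R u v) (huv : u ≠ v)
    (ht : Tough I (P.union (L.union R))) {k : ℤ} (hp : Prof I P u v k)
    (hh : Half I (P.union (L.union R)) u v) :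
    ∃ S, v ∈ S ∧ -1 ≤ R.bal I S := by
  obtain ⟨S, hu, hv, hS⟩ := (h.twoSum huv).bal_env_of_half hp hh
  have h1 := bal_union_of_inter_eq_empty (S := S) h.left.right h.right.right h.inter
  have h2 := h.bal_left_le huv ht hu
  exact ⟨S, hv, by omega⟩

/-- A series join of edges and of pairs of parallel paths. The two propositions say that
there is nothing before the first or after the last of them; in that case it has to be an edge. -/
def IsBeads : BinTree → Prop → Prop → Prop
  | leaf, _, _ => True
  | ser a b, l, r => a.IsBeads l False ∧ b.IsBeads False r
  | par a b, l, r => (par a b).IsChain ∧ ¬ l ∧ ¬ r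

theorem Builds.isBeads (h : Builds I b P u v) (hb : Between I L P R u v)
    (hG : P.union (L.union R) = G) (ht : Tough I G) (hcrit : ∀ e ∈ P.edges, Critical I G e) :
    b.IsBeads (L.verts = {u}) (R.verts = {v}) := by
  induction h generalizing L R with
  | leaf => trivial
  | ser a b P Q x w y hP hQ h ihP ihQ =>
    have hb' : Between I R (Q.union P) L y x := by rw [union_comm]; exact hb.swap
    have h1 := hb.fst h hP.base hQ.base
    have h2 := (hb'.fst h.symm hQ.base.swap hP.base.swap).swap
    have ha := ihP h1 (by rw [← hG]; ext <;> simp [union] <;> tauto)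
      fun e he => hcrit e (Or.inl he)
    have hb'' := ihQ h2 (by rw [← hG]; ext <;> simp [union] <;> tauto)
      fun e he => hcrit e (Or.inr he)
    have e1 : ((Q.union R).verts = {w}) = False := by
      refine eq_false fun h0 => hQ.base.ne.symm ?_
      have : y ∈ (Q.union R).verts := Or.inl hQ.base.snd_mem
      rwa [h0] at this
    have e2 : ((P.union L).verts = {w}) = False := by
      refine eq_false fun h0 => hP.base.ne ?_
      have : x ∈ (P.union L).verts := Or.inl hP.base.fst_mem
      rwa [h0] at this
    rw [e1] at ha
    rw [e2] at hb''
    exact ⟨ha, hb''⟩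
  | par a b P Q u v hP hQ h ihP ihQ =>
    have huv := hP.base.ne
    have hPE := hb.twoSum huv
    have hQP : TwoSum I (Q.union P) (L.union R) u v := by rwa [union_comm]
    -- Although `L ∪ R` does not connect the terminals, the sibling does, so the classification
    -- applies to each of the two branches.
    have ha := hP.summary (E := Q.union (L.union R)) (by rw [← union_assoc, hG])
      (h.assoc hPE) ht
      (hQ.base.linked.union_left hQ.base.fst_mem hQ.base.snd_mem)
      fun e he => hcrit e (Or.inl he)
    have hb' := hQ.summary (E := P.union (L.union R))
      (by rw [← union_assoc, union_comm Q P, hG]) (h.symm.assoc hQP) ht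
      (hP.base.linked.union_left hP.base.fst_mem hP.base.snd_mem)
      fun e he => hcrit e (Or.inr he)
    subst hG
    have hs := Summary.par h hPE ht hP hQ hcrit ha hb'
    -- The two tight sets give `L` and `R` balances of at least -1 with their attachment vertices
    -- deleted. A single deleted vertex has balance -2, so neither piece is trivial. As `L` and `R`
    -- are disjoint, the two sets combine to `(k - 4) - 2 + 4 ≤ 0`.
    have key : ∀ k : ℤ, Prof I (P.union Q) u v k → Low I (P.union Q) u v k →
        Half I ((P.union Q).union (L.union R)) u v →
        Half I ((P.union Q).union (L.union R)) v u →
        k ≤ 2 ∧ L.verts ≠ {u} ∧ R.verts ≠ {v} := by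
      intro k hp hl hu hv
      obtain ⟨S, hvS, hS⟩ := hb.exists_of_half huv ht hp hu
      rw [union_comm L R] at ht hv
      obtain ⟨T, huT, hT⟩ := hb.swap.exists_of_half huv.symm ht hp.swap hv
      rw [union_comm R L] at ht
      refine ⟨?_, fun h0 => ?_, fun h0 => ?_⟩
      · obtain ⟨Z, hZ1, hZ2⟩ := exists_combination (P := L) (Q := R) T S (by
          rw [hb.inter]
          simp)
        obtain ⟨W, huW, hvW, hW⟩ := hl
        have h1 := bal_union_of_inter_eq_empty (S := Z) hb.left.right hb.right.right hb.inter
        have h2 := hPE.tough_both ht huW hvW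
          ((mem_iff_of_inter_eq hZ1 hb.left.mem_right).2 huT)
          ((mem_iff_of_inter_eq hZ2 hb.right.mem_right).2 hvS)
        rw [bal_congr hZ1, bal_congr hZ2] at h1
        omega
      · have := bal_eq_of_verts_eq_singleton (I := I) h0 huT
        omega
      · have := bal_eq_of_verts_eq_singleton (I := I) h0 hvS
        omega
    rcases hs with ⟨hs, -⟩ | ⟨hs, hp, hl, hu, hv⟩ | ⟨-, hp, hl, hu, hv⟩
    · exact hs.elim
    · exact ⟨hs, (key _ hp hl hu hv).2⟩
    · exact absurd (key _ hp hl hu hv).1 (by norm_num)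

end BinTree

/-! ### Translation of toughness and criticality into balances -/

namespace Graph
open GraphPart

variable {α β : Type*} {I G : Graph α β}

/-- A locally constant function amounts to a function on the set of components, by evaluation at
representatives. -/
theorem numComponents_eq_finrank (H : Graph α β) {F : Set β} (hfin : V(H).Finite)
    (hadj : ∀ x ∈ V(H), ∀ y ∈ V(H), H.Adj x y ↔ ∃ e ∈ F, I.IsLink e x y) :
    H.numComponents = Module.finrank ℚ (I.locConst V(H) F) := by
  classical
  have := hfin.to_subtype
  set A := SimpleGraph.fromRel (fun x y : V(H) => H.Adj (x : α) (y : α)) with hA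
  have := Fintype.ofFinite A.ConnectedComponent
  have hr : ∀ f ∈ I.locConst V(H) F, ∀ x y : V(H), A.Adj x y → f x = f y := by
    rintro f ⟨-, hf⟩ x y hxy
    rw [hA, SimpleGraph.fromRel_adj] at hxy
    rcases hxy.2 with h | h
    · obtain ⟨e, he, hl⟩ := (hadj x x.2 y y.2).1 h
      exact hf e he x y hl x.2 y.2
    · obtain ⟨e, he, hl⟩ := (hadj y y.2 x x.2).1 h
      exact hf e he x y hl.symm x.2 y.2
  have hr' : ∀ f ∈ I.locConst V(H) F, ∀ x y : V(H), A.Reachable x y → f x = f y := by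
    rintro f hf x y ⟨p⟩
    induction p with
    | nil => rfl
    | cons h _ ih => exact (hr f hf _ _ h).trans ih
  let φ : I.locConst V(H) F →ₗ[ℚ] (A.ConnectedComponent → ℚ) :=
    { toFun := fun f c => f.1 c.out
      map_add' := fun _ _ => rfl
      map_smul' := fun _ _ => rfl }
  have hout : ∀ x : V(H), A.Reachable (A.connectedComponentMk x).out x := fun x =>
    SimpleGraph.ConnectedComponent.exact (Quot.out_eq (A.connectedComponentMk x))
  have hφ : Function.Bijective φ := by
    constructor
    · rintro f g h
      ext x
      by_cases hx : x ∈ V(H)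
      · have h1 := congrFun h (A.connectedComponentMk ⟨x, hx⟩)
        have h2 := hr' f.1 f.2 _ _ (hout ⟨x, hx⟩)
        have h3 := hr' g.1 g.2 _ _ (hout ⟨x, hx⟩)
        exact h2.symm.trans (h1.trans h3)
      · rw [f.2.1 x hx, g.2.1 x hx]
    · intro g
      refine ⟨⟨fun x => if h : x ∈ V(H) then g (A.connectedComponentMk ⟨x, h⟩) else 0,
        fun x hx => by simp [hx], fun e he x y hl hx hy => ?_⟩, ?_⟩
      · have hc : A.connectedComponentMk ⟨x, hx⟩ = A.connectedComponentMk ⟨y, hy⟩ := by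
          by_cases hxy : x = y
          · subst hxy
            rfl
          · refine SimpleGraph.ConnectedComponent.sound (SimpleGraph.Adj.reachable ?_)
            rw [hA, SimpleGraph.fromRel_adj]
            exact ⟨fun h => hxy (congrArg Subtype.val h), Or.inl ((hadj x hx y hy).2 ⟨e, he, hl⟩)⟩
        simp [hx, hy, hc]
      · ext c
        have : A.connectedComponentMk c.out = c := Quot.out_eq c
        change (if h : (c.out : α) ∈ V(H) then g (A.connectedComponentMk ⟨c.out, h⟩) else 0) = g c
        simp [this]
  rw [(LinearEquiv.ofBijective φ hφ).finrank_eq, Module.finrank_fintype_fun_eq_card,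
    ← Nat.card_eq_fintype_card]
  rfl

/-- The whole graph as a part of itself. -/
def toPart (G : Graph α β) : GraphPart α β := ⟨V(G), E(G)⟩

theorem numComponents_deleteVerts (hfin : V(G).Finite) (S : Set α) :
    (G.deleteVerts S).numComponents = G.toPart.comps G S := by
  rw [numComponents_eq_finrank (I := G) (F := E(G)), vertexSet_deleteVerts]
  · rfl
  · rw [vertexSet_deleteVerts]
    exact hfin.subset Set.sdiff_subset
  · simp only [vertexSet_deleteVerts, Graph.Adj, deleteVerts_isLink]
    rintro x ⟨hx, hxS⟩ y ⟨hy, hyS⟩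
    constructor
    · rintro ⟨e, hl, -⟩
      exact ⟨e, hl.edge_mem, hl⟩
    · rintro ⟨e, -, hl⟩
      exact ⟨e, hl, hxS, hyS⟩

theorem numComponents_deleteEdges_deleteVerts (hfin : V(G).Finite) (e : β) (S : Set α) :
    ((G.deleteEdges {e}).deleteVerts S).numComponents = (G.toPart.del e).comps G S := by
  rw [numComponents_eq_finrank (I := G) (F := E(G) \ {e}), vertexSet_deleteVerts,
    vertexSet_deleteEdges]
  · rfl
  · rw [vertexSet_deleteVerts]
    exact hfin.subset Set.sdiff_subset
  · simp only [vertexSet_deleteVerts, Graph.Adj, deleteVerts_isLink, deleteEdges_isLink]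
    rintro x ⟨hx, hxS⟩ y ⟨hy, hyS⟩
    constructor
    · rintro ⟨e, ⟨hl, he⟩, -⟩
      exact ⟨e, ⟨hl.edge_mem, he⟩, hl⟩
    · rintro ⟨e, he, hl⟩
      exact ⟨e, ⟨hl, he.2⟩, hxS, hyS⟩

/-- The supremum is attained, because each vertex set imposes a non-strict inequality that survives
passing to the limit in `t`. -/
theorem isTough_of_toughness_eq {t : ℝ} (h : G.toughness = (t : EReal)) : G.IsTough t := by
  intro S hS hc
  refine le_of_forall_lt fun r hr => ?_
  have hc0 : (0 : ℝ) < ((G.deleteVerts (S : Set α)).numComponents : ℝ) := by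
    exact_mod_cast (by omega : 0 < (G.deleteVerts (S : Set α)).numComponents)
  have h1 : ((r / (G.deleteVerts (S : Set α)).numComponents : ℝ) : EReal) < G.toughness := by
    rw [h, EReal.coe_lt_coe_iff, div_lt_iff₀ hc0]
    exact hr
  rw [toughness] at h1
  simp only [lt_iSup_iff] at h1
  obtain ⟨t', ht', h2⟩ := h1
  rw [EReal.coe_lt_coe_iff, div_lt_iff₀ hc0] at h2
  exact h2.trans_le (ht' S hS hc)

theorem not_isTough_of_toughness_lt {t : ℝ} (h : G.toughness < (t : EReal)) : ¬ G.IsTough t :=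
  fun ht => h.not_ge (le_iSup₂ (f := fun (t : ℝ) (_ : G.IsTough t) => (t : EReal)) t ht)

theorem IsTough.tough (h : G.IsTough (1 / 2)) (hfin : V(G).Finite) : Tough G G.toPart := by
  intro S
  have hf : (S ∩ V(G)).Finite := hfin.subset Set.inter_subset_right
  have h1 := h hf.toFinset (by simp)
  rw [Set.Finite.coe_toFinset, numComponents_deleteVerts hfin,
    ← Set.ncard_eq_toFinset_card _ hf] at h1
  have h2 : G.toPart.comps G (S ∩ V(G)) = G.toPart.comps G S :=
    comps_congr (by rw [toPart, Set.inter_assoc, Set.inter_self])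
  rw [h2] at h1
  have h3 : 1 < G.toPart.comps G S → G.toPart.comps G S ≤ 2 * (S ∩ V(G)).ncard := by
    intro hc
    have := h1 hc
    have : (G.toPart.comps G S : ℝ) ≤ 2 * ((S ∩ V(G)).ncard : ℝ) := by linarith
    exact_mod_cast this
  change (G.toPart.comps G S : ℤ) - 2 * ((S ∩ V(G)).ncard : ℤ) ≤ 1 ∧
    (S ∩ V(G) ≠ ∅ → (G.toPart.comps G S : ℤ) - 2 * ((S ∩ V(G)).ncard : ℤ) ≤ 0)
  refine ⟨by omega, fun hne => ?_⟩
  have := (Set.ncard_pos hf).2 (Set.nonempty_iff_ne_empty.2 hne)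
  omega

theorem critical_of_not_isTough {e : β} (h : ¬ (G.deleteEdges {e}).IsTough (1 / 2))
    (hfin : V(G).Finite) : Critical G G.toPart e := by
  simp only [IsTough, not_forall, not_le] at h
  obtain ⟨S, hS, hc, hlt⟩ := h
  rw [numComponents_deleteEdges_deleteVerts hfin] at hc hlt
  rw [vertexSet_deleteEdges] at hS
  have h1 : ((S : Set α) ∩ V(G)).ncard = S.card := by
    rw [Set.inter_eq_left.2 hS, Set.ncard_coe_finset]
  have h2 : 2 * S.card < (G.toPart.del e).comps G S := by
    have : 2 * (S.card : ℝ) < ((G.toPart.del e).comps G S : ℝ) := by linarith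
    exact_mod_cast this
  refine ⟨S, ?_, fun h0 => ?_⟩
  · change (1 : ℤ) ≤ ((G.toPart.del e).comps G S : ℤ) - 2 * (((S : Set α) ∩ V(G)).ncard : ℤ)
    omega
  · change (2 : ℤ) ≤ ((G.toPart.del e).comps G S : ℤ) - 2 * (((S : Set α) ∩ V(G)).ncard : ℤ)
    have h0 : (S : Set α) ∩ V(G) = ∅ := h0
    rw [h0, Set.ncard_empty]
    omega

end Graph

/-! ### Iterated joins as unions of initial segments -/

namespace GraphPart

variable {α β : Type*}

/-- The union of the parts `P 0, …, P n`. -/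
def prefixUnion (P : ℕ → GraphPart α β) : ℕ → GraphPart α β
  | 0 => P 0
  | n + 1 => (prefixUnion P n).union (P (n + 1))

theorem mem_verts_prefixUnion {P : ℕ → GraphPart α β} {n : ℕ} {v : α} :
    v ∈ (prefixUnion P n).verts ↔ ∃ i ≤ n, v ∈ (P i).verts := by
  induction n with
  | zero => simp [prefixUnion]
  | succ n ih =>
    rw [prefixUnion, verts_union, Set.mem_union, ih]
    constructor
    · rintro (⟨i, hi, h⟩ | h)
      exacts [⟨i, by omega, h⟩, ⟨n + 1, le_rfl, h⟩]
    · rintro ⟨i, hi, h⟩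
      rcases Nat.le_succ_iff.1 hi with hi | rfl
      exacts [Or.inl ⟨i, hi, h⟩, Or.inr h]

theorem mem_edges_prefixUnion {P : ℕ → GraphPart α β} {n : ℕ} {e : β} :
    e ∈ (prefixUnion P n).edges ↔ ∃ i ≤ n, e ∈ (P i).edges := by
  induction n with
  | zero => simp [prefixUnion]
  | succ n ih =>
    rw [prefixUnion, edges_union, Set.mem_union, ih]
    constructor
    · rintro (⟨i, hi, h⟩ | h)
      exacts [⟨i, by omega, h⟩, ⟨n + 1, le_rfl, h⟩]
    · rintro ⟨i, hi, h⟩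
      rcases Nat.le_succ_iff.1 hi with hi | rfl
      exacts [Or.inl ⟨i, hi, h⟩, Or.inr h]

theorem disjoint_prefixUnion {P : ℕ → GraphPart α β} {n : ℕ}
    (h : ∀ i ≤ n, Disjoint (P i).edges (P (n + 1)).edges) :
    Disjoint (prefixUnion P n).edges (P (n + 1)).edges := by
  rw [Set.disjoint_left]
  intro e he
  obtain ⟨i, hi, hei⟩ := mem_edges_prefixUnion.1 he
  exact Set.disjoint_left.1 (h i hi) hei

end GraphPart

namespace BinTree
open GraphPart

variable {α β : Type*} {I : Graph α β}

/-- The series join of the trees `b 0, …, b n`. -/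
def serFold (b : ℕ → BinTree) : ℕ → BinTree
  | 0 => b 0
  | n + 1 => ser (serFold b n) (b (n + 1))

/-- The parallel join of the trees `b 0, …, b n`. -/
def parFold (b : ℕ → BinTree) : ℕ → BinTree
  | 0 => b 0
  | n + 1 => par (parFold b n) (b (n + 1))

theorem builds_serFold {b : ℕ → BinTree} {P : ℕ → GraphPart α β} {x : ℕ → α} {n : ℕ}
    (hb : ∀ i ≤ n, Builds I (b i) (P i) (x i) (x (i + 1)))
    (hd : ∀ i j, i < j → j ≤ n → Disjoint (P i).edges (P j).edges)
    (hi : ∀ i j, i < j → j ≤ n → ∀ v ∈ (P i).verts, v ∈ (P j).verts → i + 1 = j ∧ v = x j) :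
    Builds I (serFold b n) (prefixUnion P n) (x 0) (x (n + 1)) := by
  induction n with
  | zero => exact hb 0 le_rfl
  | succ n ih =>
    have h1 := ih (fun i hi => hb i (by omega)) (fun i j hij hj => hd i j hij (by omega))
      (fun i j hij hj => hi i j hij (by omega))
    have h2 := hb (n + 1) le_rfl
    refine .ser _ _ _ _ _ _ _ h1 h2 ⟨h1.base.closed, h2.base.closed, ?_, ?_⟩
    · ext v
      constructor
      · rintro ⟨hv, hv'⟩
        obtain ⟨i, hin, hvi⟩ := mem_verts_prefixUnion.1 hv
        exact (hi i (n + 1) (by omega) le_rfl v hvi hv').2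
      · rintro rfl
        exact ⟨h1.base.snd_mem, h2.base.fst_mem⟩
    · exact disjoint_prefixUnion fun i hin => hd i (n + 1) (by omega) le_rfl

theorem builds_parFold {b : ℕ → BinTree} {P : ℕ → GraphPart α β} {u v : α} {n : ℕ}
    (hb : ∀ i ≤ n, Builds I (b i) (P i) u v)
    (hd : ∀ i j, i < j → j ≤ n → Disjoint (P i).edges (P j).edges)
    (hi : ∀ i j, i < j → j ≤ n → (P i).verts ∩ (P j).verts = {u, v}) :
    Builds I (parFold b n) (prefixUnion P n) u v := by
  induction n with
  | zero => exact hb 0 le_rfl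
  | succ n ih =>
    have h1 := ih (fun i hi => hb i (by omega)) (fun i j hij hj => hd i j hij (by omega))
      (fun i j hij hj => hi i j hij (by omega))
    have h2 := hb (n + 1) le_rfl
    refine .par _ _ _ _ _ _ h1 h2 ⟨h1.base.closed, h2.base.closed, ?_, h1.base.ne, ?_⟩
    · ext z
      constructor
      · rintro ⟨hz, hz'⟩
        obtain ⟨i, hin, hzi⟩ := mem_verts_prefixUnion.1 hz
        rw [← hi i (n + 1) (by omega) le_rfl]
        exact ⟨hzi, hz'⟩
      · rintro (rfl | rfl)
        exacts [⟨h1.base.fst_mem, h2.base.fst_mem⟩, ⟨h1.base.snd_mem, h2.base.snd_mem⟩]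
    · exact disjoint_prefixUnion fun i hin => hd i (n + 1) (by omega) le_rfl

theorem isPath_serFold {b : ℕ → BinTree} {n : ℕ} (h : (serFold b n).IsPath) :
    ∀ i ≤ n, (b i).IsPath := by
  induction n with
  | zero =>
    intro i hi
    rwa [Nat.le_zero.1 hi]
  | succ n ih =>
    intro i hi
    rcases Nat.le_succ_iff.1 hi with hi | rfl
    exacts [ih h.1 i hi, h.2]

/-- Only the first child inherits `l` and only the last one inherits `r`; every other side is set to
`False`. -/
theorem isBeads_serFold {b : ℕ → BinTree} {n : ℕ} {l r : Prop} (h : (serFold b n).IsBeads l r) :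
    ∀ i ≤ n, ∃ l' r' : Prop, (i = 0 → l → l') ∧ (i = n → r → r') ∧ (b i).IsBeads l' r' := by
  induction n generalizing r with
  | zero =>
    intro i hi
    rw [Nat.le_zero.1 hi]
    exact ⟨l, r, fun _ h => h, fun _ h => h, h⟩
  | succ n ih =>
    intro i hi
    rcases Nat.le_succ_iff.1 hi with hi | rfl
    · obtain ⟨l', r', hl, hr, hb⟩ := ih h.1 i hi
      exact ⟨l', r', hl, by omega, hb⟩
    · exact ⟨False, r, by omega, fun _ h => h, h.2⟩

end BinTree

/-! ### From trees with arbitrary branching to binary trees -/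

namespace SPTree
open GraphPart BinTree

/-- All nodes other than leaves have at least two children. -/
def IsProper : SPTree → Prop
  | leaf => True
  | series k c => 2 ≤ k ∧ ∀ i, (c i).IsProper
  | parallel k c => 2 ≤ k ∧ ∀ i, (c i).IsProper

/-- The binary tree in which joins of several graphs are replaced by iterated joins. -/
def toBin : SPTree → BinTree
  | leaf => BinTree.leaf
  | series k c => serFold (fun n => if h : n < k then (c ⟨n, h⟩).toBin else BinTree.leaf) (k - 1)
  | parallel k c => parFold (fun n => if h : n < k then (c ⟨n, h⟩).toBin else BinTree.leaf) (k - 1)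

variable {α β : Type*} {I G : Graph α β} {T : SPTree} {s t : α}

theorem Realizes.isProper (h : T.Realizes G s t) : T.IsProper := by
  induction h with
  | leaf => trivial
  | series k hk c H x G hc hG ih => exact ⟨hk, ih⟩
  | parallel k hk c H s t G hc hG ih => exact ⟨hk, ih⟩

theorem edgeDisjointUnion_le {k : ℕ} {H : Fin k → Graph α β} (h : Graph.IsEdgeDisjointUnion H G)
    (i : Fin k) : H i ≤ G := by
  refine ⟨?_, fun e x y hl => (h.isLink_iff e x y).2 ⟨i, hl⟩⟩
  rw [h.vertexSet_eq]
  exact Set.subset_iUnion (fun i => V(H i)) i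

theorem edgeDisjointUnion_mem_edgeSet {k : ℕ} {H : Fin k → Graph α β}
    (h : Graph.IsEdgeDisjointUnion H G) (e : β) : e ∈ E(G) ↔ ∃ i, e ∈ E(H i) := by
  constructor
  · intro he
    obtain ⟨x, y, hl⟩ := Graph.exists_isLink_of_mem_edgeSet he
    obtain ⟨i, hl⟩ := (h.isLink_iff e x y).1 hl
    exact ⟨i, hl.edge_mem⟩
  · rintro ⟨i, hi⟩
    exact (edgeDisjointUnion_le h i).edgeSet_mono hi

/-- Extension of a finite sequence of graphs by empty parts. -/
noncomputable def partSeq {k : ℕ} (H : Fin k → Graph α β) (n : ℕ) : GraphPart α β :=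
  if h : n < k then (H ⟨n, h⟩).toPart else ⟨∅, ∅⟩

theorem partSeq_of_lt {k : ℕ} (H : Fin k → Graph α β) {n : ℕ} (h : n < k) :
    partSeq H n = (H ⟨n, h⟩).toPart := dif_pos h

theorem prefixUnion_partSeq {m : ℕ} {H : Fin (m + 1) → Graph α β}
    (h : Graph.IsEdgeDisjointUnion H G) : prefixUnion (partSeq H) m = G.toPart := by
  ext z
  · rw [mem_verts_prefixUnion]
    change _ ↔ z ∈ V(G)
    rw [h.vertexSet_eq, Set.mem_iUnion]
    constructor
    · rintro ⟨i, hi, hz⟩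
      rw [partSeq_of_lt H (by omega)] at hz
      exact ⟨_, hz⟩
    · rintro ⟨i, hz⟩
      refine ⟨i, by omega, ?_⟩
      rw [partSeq_of_lt H i.2]
      exact hz
  · rw [mem_edges_prefixUnion]
    change _ ↔ z ∈ E(G)
    rw [edgeDisjointUnion_mem_edgeSet h]
    constructor
    · rintro ⟨i, hi, hz⟩
      rw [partSeq_of_lt H (by omega)] at hz
      exact ⟨_, hz⟩
    · rintro ⟨i, hz⟩
      refine ⟨i, by omega, ?_⟩
      rw [partSeq_of_lt H i.2]
      exact hz

/-- The ambient graph `I` stays fixed through the induction, so that all subgraphs become parts of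
one graph. -/
theorem Realizes.builds (h : T.Realizes G s t) (hG : G ≤ I) : Builds I T.toBin G.toPart s t := by
  induction h with
  | leaf e s t hst =>
    have : (Graph.banana s t {e}).toPart = (⟨{s, t}, {e}⟩ : GraphPart α β) := rfl
    rw [this]
    exact .leaf e s t hst (Graph.IsLink.mono hG (by simp))
  | series k hk c H x G hc hJ ih =>
    obtain ⟨m, rfl⟩ : ∃ m, k = m + 1 := ⟨k - 1, by omega⟩
    have hle := fun i => edgeDisjointUnion_le hJ.union i
    let y : ℕ → α := fun n => if h : n < m + 2 then x ⟨n, h⟩ else x 0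
    have hy : ∀ n (h : n < m + 2), y n = x ⟨n, h⟩ := fun n h => dif_pos h
    have key := builds_serFold (I := I) (n := m)
      (b := fun n => if h : n < m + 1 then (c ⟨n, h⟩).toBin else BinTree.leaf)
      (P := partSeq H) (x := y) ?_ ?_ ?_
    · rw [prefixUnion_partSeq hJ.union, hy 0 (by omega), hy (m + 1) (by omega)] at key
      exact key
    · intro i hi
      have hi' : i < m + 1 := by omega
      have := ih ⟨i, hi'⟩ ((hle _).trans hG)
      rw [partSeq_of_lt H hi', hy i (by omega), hy (i + 1) (by omega)]
      simpa [hi'] using this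
    · intro i j hij hj
      rw [partSeq_of_lt H (by omega : i < m + 1), partSeq_of_lt H (by omega : j < m + 1)]
      exact hJ.union.disjoint _ _ (by simp [Fin.ext_iff]; omega)
    · intro i j hij hj v
      rw [partSeq_of_lt H (by omega : i < m + 1), partSeq_of_lt H (by omega : j < m + 1),
        hy j (by omega)]
      exact fun hv hv' => hJ.inter ⟨i, by omega⟩ ⟨j, by omega⟩ hij v hv hv'
  | parallel k hk c H s t G hc hJ ih =>
    obtain ⟨m, rfl⟩ : ∃ m, k = m + 1 := ⟨k - 1, by omega⟩
    have hle := fun i => edgeDisjointUnion_le hJ.union i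
    have key := builds_parFold (I := I) (n := m) (u := s) (v := t)
      (b := fun n => if h : n < m + 1 then (c ⟨n, h⟩).toBin else BinTree.leaf)
      (P := partSeq H) ?_ ?_ ?_
    · rw [prefixUnion_partSeq hJ.union] at key
      exact key
    · intro i hi
      have hi' : i < m + 1 := by omega
      have := ih ⟨i, hi'⟩ ((hle _).trans hG)
      rw [partSeq_of_lt H hi']
      simpa [hi'] using this
    · intro i j hij hj
      rw [partSeq_of_lt H (by omega : i < m + 1), partSeq_of_lt H (by omega : j < m + 1)]
      exact hJ.union.disjoint _ _ (by simp [Fin.ext_iff]; omega)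
    · intro i j hij hj
      rw [partSeq_of_lt H (by omega : i < m + 1), partSeq_of_lt H (by omega : j < m + 1)]
      exact hJ.inter _ _ (by simp [Fin.ext_iff]; omega)

/-- A series node all of whose children are leaves. -/
def IsThread (T : SPTree) : Prop := ∃ k, 2 ≤ k ∧ T = series k fun _ => leaf

/-- The last child is split off. With more than two children the remaining branch is again a
parallel join and so cannot be a path, which leaves two children in `isThread_of_isChain`. -/
theorem parFold_toBin_eq {k : ℕ} (hk : 2 ≤ k) (c : Fin k → SPTree) :
    ∃ a, (parallel k c).toBin = BinTree.par a (c ⟨k - 1, by omega⟩).toBin ∧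
      (k = 2 → a = (c ⟨0, by omega⟩).toBin) ∧ (2 < k → ∃ a₁ a₂, a = BinTree.par a₁ a₂) := by
  obtain ⟨m, rfl⟩ : ∃ m, k = m + 2 := ⟨k - 2, by omega⟩
  refine ⟨parFold (fun n => if h : n < m + 2 then (c ⟨n, h⟩).toBin else BinTree.leaf) m,
    ?_, ?_, ?_⟩
  · simp [toBin, parFold]
  · intro h
    obtain rfl : m = 0 := by omega
    simp [parFold]
  · intro h
    obtain ⟨j, rfl⟩ : ∃ j, m = j + 1 := ⟨m - 1, by omega⟩
    exact ⟨_, _, rfl⟩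

theorem eq_leaf_of_isPath (hT : T.IsProper) (hs : ¬ T.IsSeries) (h : T.toBin.IsPath) :
    T = leaf := by
  cases T with
  | leaf => rfl
  | series k c => exact absurd trivial hs
  | parallel k c =>
    obtain ⟨a, ha, -⟩ := parFold_toBin_eq hT.1 c
    rw [ha] at h
    exact h.elim

theorem isThread_of_isPath (hT : T.IsProper) (ha : T.IsAlternating) (h : T.toBin.IsPath)
    (hne : T.toBin ≠ BinTree.leaf) : T.IsThread := by
  cases T with
  | leaf => exact absurd rfl hne
  | parallel k c => exact absurd (eq_leaf_of_isPath hT id h) (by simp)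
  | series k c =>
    refine ⟨k, hT.1, ?_⟩
    congr 1
    ext i
    have h1 := isPath_serFold h i (by omega)
    simp only [i.2, dif_pos] at h1
    exact eq_leaf_of_isPath (hT.2 i) (ha i).1 h1

theorem isThread_of_isChain {k : ℕ} {c : Fin k → SPTree} (hT : (parallel k c).IsProper)
    (ha : (parallel k c).IsAlternating) (h : (parallel k c).toBin.IsChain) :
    k = 2 ∧ ∀ i, (c i).IsThread := by
  obtain ⟨a, hb, h2, h3⟩ := parFold_toBin_eq hT.1 c
  rw [hb] at h
  have hk : k = 2 := by
    by_contra hne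
    obtain ⟨a₁, a₂, rfl⟩ := h3 (by have := hT.1; omega)
    exact h.1.1
  subst hk
  refine ⟨rfl, fun i => ?_⟩
  rw [h2 rfl] at h
  fin_cases i
  · exact isThread_of_isPath (hT.2 _) (ha _).2 h.1.1 h.1.2
  · exact isThread_of_isPath (hT.2 _) (ha _).2 h.2.1 h.2.2

theorem children_of_isBeads {k : ℕ} {c : Fin k → SPTree} (hT : (series k c).IsProper)
    (ha : (series k c).IsAlternating) (h : (series k c).toBin.IsBeads True True) (i : Fin k) :
    c i = leaf ∨ (i.val ≠ 0 ∧ i.val + 1 ≠ k) ∧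
      ∃ d : Fin 2 → SPTree, c i = parallel 2 d ∧ ∀ j, (d j).IsThread := by
  obtain ⟨l, r, hl, hr, hb⟩ := isBeads_serFold h i (by omega)
  simp only [i.2, dif_pos] at hb
  have hp := hT.2 i
  have hai := ha i
  revert hb hp hai
  generalize c i = T
  intro hb hp hai
  cases T with
  | leaf => exact Or.inl rfl
  | series k' c' => exact absurd trivial hai.1
  | parallel k' c' =>
    obtain ⟨a, ha', -⟩ := parFold_toBin_eq hp.1 c'
    rw [ha'] at hb
    obtain ⟨hc, hl', hr'⟩ := hb
    rw [← ha'] at hc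
    obtain ⟨rfl, hd⟩ := isThread_of_isChain hp hai.2 hc
    exact Or.inr ⟨⟨fun h => hl' (hl h trivial), fun h => hr' (hr (by omega) trivial)⟩, c', rfl, hd⟩

end SPTree

/-! ### Existence of an alternating tree -/

namespace SPTree
open GraphPart BinTree

variable {α β : Type*} {I G : Graph α β} {T : SPTree} {s t u v w : α} {P Q : GraphPart α β}

theorem oneSum_prefixUnion {b : ℕ → BinTree} {P : ℕ → GraphPart α β} {x : ℕ → α} {n : ℕ}
    (hb : ∀ i ≤ n + 1, Builds I (b i) (P i) (x i) (x (i + 1)))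
    (hd : ∀ i j, i < j → j ≤ n + 1 → Disjoint (P i).edges (P j).edges)
    (hi : ∀ i j, i < j → j ≤ n + 1 → ∀ v ∈ (P i).verts, v ∈ (P j).verts → i + 1 = j ∧ v = x j) :
    OneSum I (prefixUnion P n) (P (n + 1)) (x (n + 1)) := by
  have h1 := (builds_serFold (fun i hi => hb i (by omega))
    (fun i j hij hj => hd i j hij (by omega)) (fun i j hij hj => hi i j hij (by omega)) :
    Builds I (serFold b n) (prefixUnion P n) (x 0) (x (n + 1))).base
  have h2 := (hb (n + 1) le_rfl).base
  refine ⟨h1.closed, h2.closed, ?_, disjoint_prefixUnion fun i hin => hd i _ (by omega) le_rfl⟩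
  ext v
  constructor
  · rintro ⟨hv, hv'⟩
    obtain ⟨i, hin, hvi⟩ := mem_verts_prefixUnion.1 hv
    exact (hi i (n + 1) (by omega) le_rfl v hvi hv').2
  · rintro rfl
    exact ⟨h1.snd_mem, h2.fst_mem⟩

/-- `P` is the series join of graphs that are realized by alternating trees whose roots are
not series nodes. -/
def AltSeries (I : Graph α β) (P : GraphPart α β) (s t : α) : Prop :=
  ∃ (n : ℕ) (H : ℕ → Graph α β) (c : ℕ → SPTree) (x : ℕ → α), x 0 = s ∧ x (n + 1) = t ∧
    (∀ i ≤ n, H i ≤ I ∧ (c i).Realizes (H i) (x i) (x (i + 1)) ∧ ¬ (c i).IsSeries ∧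
      (c i).IsAlternating) ∧
    (∀ i j, i < j → j ≤ n → Disjoint E(H i) E(H j)) ∧
    (∀ i j, i < j → j ≤ n → ∀ v ∈ V(H i), v ∈ V(H j) → i + 1 = j ∧ v = x j) ∧
    P = prefixUnion (fun i => (H i).toPart) n

/-- `P` is the parallel join of graphs that are realized by alternating trees whose roots are
not parallel nodes. -/
def AltParallel (I : Graph α β) (P : GraphPart α β) (s t : α) : Prop :=
  ∃ (n : ℕ) (H : ℕ → Graph α β) (c : ℕ → SPTree),
    (∀ i ≤ n, H i ≤ I ∧ (c i).Realizes (H i) s t ∧ ¬ (c i).IsParallel ∧ (c i).IsAlternating) ∧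
    (∀ i j, i < j → j ≤ n → Disjoint E(H i) E(H j)) ∧
    (∀ i j, i < j → j ≤ n → V(H i) ∩ V(H j) = {s, t}) ∧
    P = prefixUnion (fun i => (H i).toPart) n

theorem prefixUnion_append (P Q : ℕ → GraphPart α β) (m n : ℕ) :
    prefixUnion (fun i => if i ≤ m then P i else Q (i - (m + 1))) (m + 1 + n) =
      (prefixUnion P m).union (prefixUnion Q n) := by
  ext z
  · simp only [verts_union, Set.mem_union, mem_verts_prefixUnion]
    constructor
    · rintro ⟨i, hi, hz⟩
      split_ifs at hz with him
      exacts [Or.inl ⟨i, him, hz⟩, Or.inr ⟨_, by omega, hz⟩]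
    · rintro (⟨i, hi, hz⟩ | ⟨i, hi, hz⟩)
      · exact ⟨i, by omega, by rwa [if_pos hi]⟩
      · refine ⟨m + 1 + i, by omega, ?_⟩
        rwa [if_neg (by omega), Nat.add_sub_cancel_left]
  · simp only [edges_union, Set.mem_union, mem_edges_prefixUnion]
    constructor
    · rintro ⟨i, hi, hz⟩
      split_ifs at hz with him
      exacts [Or.inl ⟨i, him, hz⟩, Or.inr ⟨_, by omega, hz⟩]
    · rintro (⟨i, hi, hz⟩ | ⟨i, hi, hz⟩)
      · exact ⟨i, by omega, by rwa [if_pos hi]⟩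
      · refine ⟨m + 1 + i, by omega, ?_⟩
        rwa [if_neg (by omega), Nat.add_sub_cancel_left]

/-- Nested series joins are flattened by concatenating the sequences of blocks. -/
theorem AltSeries.append (hP : AltSeries I P s w) (hQ : AltSeries I Q w t) (h : OneSum I P Q w) :
    AltSeries I (P.union Q) s t := by
  obtain ⟨m, H, c, x, rfl, hxw, hc, hd, hi, hPu⟩ := hP
  obtain ⟨n, K, d, y, hyw, rfl, hc', hd', hi', hQu⟩ := hQ
  have hbase : ∀ i ≤ m, Base I (H i).toPart (x i) (x (i + 1)) :=
    fun i hi => ((hc i hi).2.1.builds (hc i hi).1).base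
  have hbase' : ∀ i ≤ n, Base I (K i).toPart (y i) (y (i + 1)) :=
    fun i hi => ((hc' i hi).2.1.builds (hc' i hi).1).base
  refine ⟨m + 1 + n, fun i => if i ≤ m then H i else K (i - (m + 1)),
    fun i => if i ≤ m then c i else d (i - (m + 1)),
    fun i => if i ≤ m then x i else y (i - (m + 1)), by simp, ?_, ?_, ?_, ?_, ?_⟩
  · beta_reduce
    rw [if_neg (by omega)]
    congr 1
    omega
  · intro i hin
    by_cases him : i ≤ m
    · have hx : (if i + 1 ≤ m then x (i + 1) else y (i + 1 - (m + 1))) = x (i + 1) := by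
        split_ifs with h1
        · rfl
        · obtain rfl : i = m := by omega
          rw [hxw, ← hyw]
          congr 1
          omega
      simp only [if_pos him, hx]
      exact hc i him
    · have := hc' (i - (m + 1)) (by omega)
      simp only [if_neg him, if_neg (by omega : ¬ i + 1 ≤ m)]
      rwa [show i + 1 - (m + 1) = i - (m + 1) + 1 by omega]
  · intro i j hij hj
    by_cases him : i ≤ m
    · by_cases hjm : j ≤ m
      · simp only [if_pos him, if_pos hjm]
        exact hd i j hij hjm
      · simp only [if_pos him, if_neg hjm]
        refine h.disj.mono ?_ ?_
        · intro e he
          rw [hPu]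
          exact mem_edges_prefixUnion.2 ⟨i, him, he⟩
        · intro e he
          rw [hQu]
          exact mem_edges_prefixUnion.2 ⟨_, by omega, he⟩
    · simp only [if_neg him, if_neg (by omega : ¬ j ≤ m)]
      exact hd' _ _ (by omega) (by omega)
  · intro i j hij hj v
    by_cases him : i ≤ m
    · by_cases hjm : j ≤ m
      · simp only [if_pos him, if_pos hjm]
        exact hi i j hij hjm v
      · simp only [if_pos him, if_neg hjm]
        intro hv hv'
        have hvw : v ∈ P.verts ∩ Q.verts := by
          rw [hPu, hQu]
          exact ⟨mem_verts_prefixUnion.2 ⟨i, him, hv⟩, mem_verts_prefixUnion.2 ⟨_, by omega, hv'⟩⟩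
        rw [h.inter] at hvw
        obtain rfl : v = w := hvw
        -- The vertex `w` is the second terminal of block `m`. If it also lay in an earlier block,
        -- it would be the first terminal of block `m`.
        have h1 : i = m := by
          by_contra hne
          have h2 := hi i m (by omega) le_rfl v hv (hxw ▸ (hbase m le_rfl).snd_mem)
          exact (hbase m le_rfl).ne (h2.2.symm.trans hxw.symm)
        have h2 : j = m + 1 := by
          by_contra hne
          have h3 := hi' 0 (j - (m + 1)) (by omega) (by omega) v
            (hyw ▸ (hbase' 0 (Nat.zero_le _)).fst_mem) hv'
          refine (hbase' 0 (Nat.zero_le _)).ne (hyw.trans (h3.2.trans ?_))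
          rw [h3.1]
        subst h1 h2
        refine ⟨rfl, ?_⟩
        rw [Nat.sub_self, hyw]
    · simp only [if_neg him, if_neg (by omega : ¬ j ≤ m)]
      intro hv hv'
      have := hi' _ _ (by omega) (by omega) v hv hv'
      exact ⟨by omega, this.2⟩
  · rw [hPu, hQu, ← prefixUnion_append]
    congr 1
    ext1 i
    beta_reduce
    split_ifs <;> rfl

theorem AltParallel.append (hP : AltParallel I P s t) (hQ : AltParallel I Q s t)
    (h : TwoSum I P Q s t) : AltParallel I (P.union Q) s t := by
  obtain ⟨m, H, c, hc, hd, hi, hPu⟩ := hP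
  obtain ⟨n, K, d, hc', hd', hi', hQu⟩ := hQ
  refine ⟨m + 1 + n, fun i => if i ≤ m then H i else K (i - (m + 1)),
    fun i => if i ≤ m then c i else d (i - (m + 1)), ?_, ?_, ?_, ?_⟩
  · intro i hin
    by_cases him : i ≤ m
    · simp only [if_pos him]
      exact hc i him
    · simp only [if_neg him]
      exact hc' _ (by omega)
  · intro i j hij hj
    by_cases him : i ≤ m
    · by_cases hjm : j ≤ m
      · simp only [if_pos him, if_pos hjm]
        exact hd i j hij hjm
      · simp only [if_pos him, if_neg hjm]
        refine h.disj.mono ?_ ?_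
        · intro e he
          rw [hPu]
          exact mem_edges_prefixUnion.2 ⟨i, him, he⟩
        · intro e he
          rw [hQu]
          exact mem_edges_prefixUnion.2 ⟨_, by omega, he⟩
    · simp only [if_neg him, if_neg (by omega : ¬ j ≤ m)]
      exact hd' _ _ (by omega) (by omega)
  · intro i j hij hj
    by_cases him : i ≤ m
    · by_cases hjm : j ≤ m
      · simp only [if_pos him, if_pos hjm]
        exact hi i j hij hjm
      · simp only [if_pos him, if_neg hjm]
        have hb := ((hc i him).2.1.builds (hc i him).1).base
        have hb' := ((hc' (j - (m + 1)) (by omega)).2.1.builds (hc' _ (by omega)).1).base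
        refine subset_antisymm ?_ ?_
        · rw [← h.inter, hPu, hQu]
          rintro v ⟨hv, hv'⟩
          exact ⟨mem_verts_prefixUnion.2 ⟨i, him, hv⟩,
            mem_verts_prefixUnion.2 ⟨_, by omega, hv'⟩⟩
        · rintro v (rfl | rfl)
          exacts [⟨hb.fst_mem, hb'.fst_mem⟩, ⟨hb.snd_mem, hb'.snd_mem⟩]
    · simp only [if_neg him, if_neg (by omega : ¬ j ≤ m)]
      exact hi' _ _ (by omega) (by omega)
  · rw [hPu, hQu, ← prefixUnion_append]
    congr 1
    ext1 i
    beta_reduce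
    split_ifs <;> rfl

theorem eq_of_toPart_eq {H : Graph α β} (hle : H ≤ G) (h : G.toPart = H.toPart) : H = G := by
  have hV : V(G) = V(H) := congrArg GraphPart.verts h
  have hE : E(G) = E(H) := congrArg GraphPart.edges h
  exact Graph.Compatible.ext hV.symm hE.symm (Graph.Compatible.of_le hle)

theorem isEdgeDisjointUnion_of_toPart_eq {n : ℕ} {H : ℕ → Graph α β} (hle : ∀ i ≤ n, H i ≤ G)
    (hd : ∀ i j, i < j → j ≤ n → Disjoint E(H i) E(H j))
    (h : G.toPart = prefixUnion (fun i => (H i).toPart) n) :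
    Graph.IsEdgeDisjointUnion (fun i : Fin (n + 1) => H i) G where
  disjoint := by
    intro i j hij
    rcases lt_or_gt_of_ne hij with h1 | h1
    · exact hd i j h1 (by omega)
    · exact (hd j i h1 (by omega)).symm
  vertexSet_eq := by
    ext v
    change v ∈ G.toPart.verts ↔ _
    rw [h, mem_verts_prefixUnion, Set.mem_iUnion]
    constructor
    · rintro ⟨i, hi, hv⟩
      exact ⟨⟨i, by omega⟩, hv⟩
    · rintro ⟨i, hv⟩
      exact ⟨i, by omega, hv⟩
  isLink_iff := by
    intro e x y
    constructor
    · intro hl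
      have : e ∈ G.toPart.edges := hl.edge_mem
      rw [h, mem_edges_prefixUnion] at this
      obtain ⟨i, hi, he⟩ := this
      exact ⟨⟨i, by omega⟩, ((hle i hi).isLink_iff he).2 hl⟩
    · rintro ⟨i, hl⟩
      exact hl.mono (hle i (by omega))

theorem AltSeries.exists_isAlternating (h : AltSeries G G.toPart s t) :
    ∃ T : SPTree, T.Realizes G s t ∧ T.IsAlternating := by
  obtain ⟨n, H, c, x, rfl, rfl, hc, hd, hi, hG⟩ := h
  rcases Nat.eq_zero_or_pos n with rfl | hn
  · obtain ⟨hle, hr, -, ha⟩ := hc 0 le_rfl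
    rw [eq_of_toPart_eq hle hG] at hr
    exact ⟨_, hr, ha⟩
  · refine ⟨series (n + 1) fun i => c i, ?_, fun i => (hc i (by omega)).2.2⟩
    refine Realizes.series (n + 1) (by omega) (fun i => c i) (fun i => H i) (fun i => x i) G
      (fun i => (hc i (by omega)).2.1) ⟨?_, ?_⟩
    · exact isEdgeDisjointUnion_of_toPart_eq (fun i hi => (hc i hi).1) hd hG
    · exact fun i j hij v hv hv' => hi i j hij (by omega) v hv hv'

theorem AltParallel.exists_isAlternating (h : AltParallel G G.toPart s t) :
    ∃ T : SPTree, T.Realizes G s t ∧ T.IsAlternating := by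
  obtain ⟨n, H, c, hc, hd, hi, hG⟩ := h
  rcases Nat.eq_zero_or_pos n with rfl | hn
  · obtain ⟨hle, hr, -, ha⟩ := hc 0 le_rfl
    rw [eq_of_toPart_eq hle hG] at hr
    exact ⟨_, hr, ha⟩
  · refine ⟨parallel (n + 1) fun i => c i, ?_, fun i => (hc i (by omega)).2.2⟩
    refine Realizes.parallel (n + 1) (by omega) (fun i => c i) (fun i => H i) s t G
      (fun i => (hc i (by omega)).2.1) ⟨?_, ?_⟩
    · exact isEdgeDisjointUnion_of_toPart_eq (fun i hi => (hc i hi).1) hd hG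
    · intro i j hij
      rcases lt_or_gt_of_ne hij with h1 | h1
      · exact hi i j h1 (by omega)
      · rw [Set.inter_comm]
        exact hi j i h1 (by omega)

/-- Extension of a finite sequence by a constant. -/
theorem exists_nat_extension {γ : Type*} {k : ℕ} (f : Fin k → γ) (d : γ) :
    ∃ g : ℕ → γ, ∀ n (h : n < k), g n = f ⟨n, h⟩ := by
  classical
  exact ⟨fun n => if h : n < k then f ⟨n, h⟩ else d, fun n h => dif_pos h⟩

theorem prefixUnion_toPart {m : ℕ} {H : Fin (m + 1) → Graph α β} {K : ℕ → Graph α β}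
    (hK : ∀ n (h : n < m + 1), K n = H ⟨n, h⟩) (h : Graph.IsEdgeDisjointUnion H G) :
    G.toPart = prefixUnion (fun i => (K i).toPart) m := by
  rw [← prefixUnion_partSeq h]
  ext z
  · simp only [mem_verts_prefixUnion]
    refine exists_congr fun i => and_congr_right fun hi => ?_
    rw [partSeq_of_lt H (by omega), hK i (by omega)]
  · simp only [mem_edges_prefixUnion]
    refine exists_congr fun i => and_congr_right fun hi => ?_
    rw [partSeq_of_lt H (by omega), hK i (by omega)]

theorem Realizes.altSeries (h : T.Realizes G s t) (ha : T.IsAlternating) (hG : G ≤ I) :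
    AltSeries I G.toPart s t := by
  by_cases hs : T.IsSeries
  · cases h with
    | leaf => exact hs.elim
    | parallel => exact hs.elim
    | series k hk c H x G hc hJ =>
      obtain ⟨m, rfl⟩ : ∃ m, k = m + 1 := ⟨k - 1, by omega⟩
      obtain ⟨H', hH⟩ := exists_nat_extension H G
      obtain ⟨c', hc'⟩ := exists_nat_extension c SPTree.leaf
      obtain ⟨x', hx⟩ := exists_nat_extension x (x 0)
      refine ⟨m, H', c', x', hx 0 (by omega), hx (m + 1) (by omega), ?_, ?_, ?_,
        prefixUnion_toPart hH hJ.union⟩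
      · intro i hi
        rw [hH i (by omega), hc' i (by omega), hx i (by omega), hx (i + 1) (by omega)]
        exact ⟨(edgeDisjointUnion_le hJ.union _).trans hG, hc ⟨i, by omega⟩, ha _⟩
      · intro i j hij hj
        rw [hH i (by omega), hH j (by omega)]
        exact hJ.union.disjoint _ _ (by simp [Fin.ext_iff]; omega)
      · intro i j hij hj v
        rw [hH i (by omega), hH j (by omega), hx j (by omega)]
        exact fun hv hv' => hJ.inter ⟨i, by omega⟩ ⟨j, by omega⟩ hij v hv hv'
  · refine ⟨0, fun _ => G, fun _ => T, fun n => if n = 0 then s else t, rfl, rfl, ?_, by omega,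
      by omega, rfl⟩
    intro i hi
    obtain rfl : i = 0 := by omega
    exact ⟨hG, h, hs, ha⟩

theorem Realizes.altParallel (h : T.Realizes G s t) (ha : T.IsAlternating) (hG : G ≤ I) :
    AltParallel I G.toPart s t := by
  by_cases hs : T.IsParallel
  · cases h with
    | leaf => exact hs.elim
    | series => exact hs.elim
    | parallel k hk c H s t G hc hJ =>
      obtain ⟨m, rfl⟩ : ∃ m, k = m + 1 := ⟨k - 1, by omega⟩
      obtain ⟨H', hH⟩ := exists_nat_extension H G
      obtain ⟨c', hc'⟩ := exists_nat_extension c SPTree.leaf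
      refine ⟨m, H', c', ?_, ?_, ?_, prefixUnion_toPart hH hJ.union⟩
      · intro i hi
        rw [hH i (by omega), hc' i (by omega)]
        exact ⟨(edgeDisjointUnion_le hJ.union _).trans hG, hc ⟨i, by omega⟩, ha _⟩
      · intro i j hij hj
        rw [hH i (by omega), hH j (by omega)]
        exact hJ.union.disjoint _ _ (by simp [Fin.ext_iff]; omega)
      · intro i j hij hj
        rw [hH i (by omega), hH j (by omega)]
        exact hJ.inter _ _ (by simp [Fin.ext_iff]; omega)
  · refine ⟨0, fun _ => G, fun _ => T, ?_, by omega, by omega, rfl⟩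
    intro i hi
    exact ⟨hG, h, hs, ha⟩

theorem altSeries_prefixUnion {b : ℕ → BinTree} {P : ℕ → GraphPart α β} {x : ℕ → α} {n : ℕ}
    (ha : ∀ i ≤ n, AltSeries I (P i) (x i) (x (i + 1)))
    (hb : ∀ i ≤ n, Builds I (b i) (P i) (x i) (x (i + 1)))
    (hd : ∀ i j, i < j → j ≤ n → Disjoint (P i).edges (P j).edges)
    (hi : ∀ i j, i < j → j ≤ n → ∀ v ∈ (P i).verts, v ∈ (P j).verts → i + 1 = j ∧ v = x j) :
    AltSeries I (prefixUnion P n) (x 0) (x (n + 1)) := by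
  induction n with
  | zero => exact ha 0 le_rfl
  | succ n ih =>
    refine AltSeries.append (ih (fun i hi => ha i (by omega)) (fun i hi => hb i (by omega))
      (fun i j hij hj => hd i j hij (by omega)) (fun i j hij hj => hi i j hij (by omega)))
      (ha (n + 1) le_rfl) (oneSum_prefixUnion hb hd hi)

theorem altParallel_prefixUnion {b : ℕ → BinTree} {P : ℕ → GraphPart α β} {n : ℕ}
    (ha : ∀ i ≤ n, AltParallel I (P i) u v) (hb : ∀ i ≤ n, Builds I (b i) (P i) u v)
    (hd : ∀ i j, i < j → j ≤ n → Disjoint (P i).edges (P j).edges)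
    (hi : ∀ i j, i < j → j ≤ n → (P i).verts ∩ (P j).verts = {u, v}) :
    AltParallel I (prefixUnion P n) u v := by
  induction n with
  | zero => exact ha 0 le_rfl
  | succ n ih =>
    have h1 := (builds_parFold (fun i hi => hb i (by omega))
      (fun i j hij hj => hd i j hij (by omega)) (fun i j hij hj => hi i j hij (by omega)) :
      Builds I (parFold b n) (prefixUnion P n) u v).base
    have h2 := (hb (n + 1) le_rfl).base
    refine AltParallel.append (ih (fun i hi => ha i (by omega)) (fun i hi => hb i (by omega))
      (fun i j hij hj => hd i j hij (by omega)) (fun i j hij hj => hi i j hij (by omega)))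
      (ha (n + 1) le_rfl) ⟨h1.closed, h2.closed, ?_, h1.ne,
        disjoint_prefixUnion fun i hin => hd i _ (by omega) le_rfl⟩
    ext z
    constructor
    · rintro ⟨hz, hz'⟩
      obtain ⟨i, hin, hzi⟩ := mem_verts_prefixUnion.1 hz
      rw [← hi i (n + 1) (by omega) le_rfl]
      exact ⟨hzi, hz'⟩
    · rintro (rfl | rfl)
      exacts [⟨h1.fst_mem, h2.fst_mem⟩, ⟨h1.snd_mem, h2.snd_mem⟩]

/-- Every series-parallel graph has an alternating tree. -/
theorem Realizes.exists_isAlternating (h : T.Realizes G s t) :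
    ∃ T' : SPTree, T'.Realizes G s t ∧ T'.IsAlternating := by
  induction h with
  | leaf e s t hst => exact ⟨SPTree.leaf, .leaf e s t hst, trivial⟩
  | series k hk c H x G hc hJ ih =>
    obtain ⟨m, rfl⟩ : ∃ m, k = m + 1 := ⟨k - 1, by omega⟩
    choose d hd hda using ih
    have hle := fun i => edgeDisjointUnion_le hJ.union i
    obtain ⟨H', hH⟩ := exists_nat_extension H G
    obtain ⟨d', hd'⟩ := exists_nat_extension d SPTree.leaf
    obtain ⟨x', hx⟩ := exists_nat_extension x (x 0)
    have key := altSeries_prefixUnion (I := G) (n := m) (b := fun i => (d' i).toBin)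
      (P := fun i => (H' i).toPart) (x := x') ?_ ?_ ?_ ?_
    · rw [← prefixUnion_toPart hH hJ.union, hx 0 (by omega), hx (m + 1) (by omega)] at key
      exact key.exists_isAlternating
    · intro i hi
      rw [hH i (by omega), hx i (by omega), hx (i + 1) (by omega)]
      exact (hd ⟨i, by omega⟩).altSeries (hda _) (hle _)
    · intro i hi
      rw [hH i (by omega), hx i (by omega), hx (i + 1) (by omega), hd' i (by omega)]
      exact (hd ⟨i, by omega⟩).builds (hle _)
    · intro i j hij hj
      rw [hH i (by omega), hH j (by omega)]
      exact hJ.union.disjoint _ _ (by simp [Fin.ext_iff]; omega)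
    · intro i j hij hj v
      rw [hH i (by omega), hH j (by omega), hx j (by omega)]
      exact fun hv hv' => hJ.inter ⟨i, by omega⟩ ⟨j, by omega⟩ hij v hv hv'
  | parallel k hk c H s t G hc hJ ih =>
    obtain ⟨m, rfl⟩ : ∃ m, k = m + 1 := ⟨k - 1, by omega⟩
    choose d hd hda using ih
    have hle := fun i => edgeDisjointUnion_le hJ.union i
    obtain ⟨H', hH⟩ := exists_nat_extension H G
    obtain ⟨d', hd'⟩ := exists_nat_extension d SPTree.leaf
    have key := altParallel_prefixUnion (I := G) (n := m) (u := s) (v := t)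
      (b := fun i => (d' i).toBin) (P := fun i => (H' i).toPart) ?_ ?_ ?_ ?_
    · rw [← prefixUnion_toPart hH hJ.union] at key
      exact key.exists_isAlternating
    · intro i hi
      rw [hH i (by omega)]
      exact (hd ⟨i, by omega⟩).altParallel (hda _) (hle _)
    · intro i hi
      rw [hH i (by omega), hd' i (by omega)]
      exact (hd ⟨i, by omega⟩).builds (hle _)
    · intro i j hij hj
      rw [hH i (by omega), hH j (by omega)]
      exact hJ.union.disjoint _ _ (by simp [Fin.ext_iff]; omega)
    · intro i j hij hj
      rw [hH i (by omega), hH j (by omega)]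
      exact hJ.inter _ _ (by simp [Fin.ext_iff]; omega)

end SPTree

/-! ### Threads, reducedness and small cases -/

namespace SPTree
open GraphPart BinTree

variable {α β : Type*} {I G H : Graph α β} {T : SPTree} {s t u v w : α}

theorem Realizes.ne_of_isLink (h : T.Realizes G s t) {e : β} {y z : α} (hl : G.IsLink e y z) :
    y ≠ z := by
  induction h with
  | leaf e' s t hst =>
    simp only [Graph.banana_isLink] at hl
    rcases hl.2 with ⟨rfl, rfl⟩ | ⟨rfl, rfl⟩
    exacts [hst, hst.symm]
  | series k hk c H x G hc hJ ih =>
    obtain ⟨i, hi⟩ := (hJ.union.isLink_iff e y z).1 hl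
    exact ih i hi
  | parallel k hk c H s t G hc hJ ih =>
    obtain ⟨i, hi⟩ := (hJ.union.isLink_iff e y z).1 hl
    exact ih i hi

theorem Realizes.base (h : T.Realizes G s t) : Base G G.toPart s t := (h.builds le_rfl).base

theorem Realizes.eq_banana (h : SPTree.leaf.Realizes G s t) :
    s ≠ t ∧ ∃ e, G = Graph.banana s t {e} := by
  cases h with
  | leaf e s t hst => exact ⟨hst, e, rfl⟩

theorem injective_of_isSeriesJoin {k : ℕ} {c : Fin k → SPTree} {H : Fin k → Graph α β}
    {x : Fin (k + 1) → α} (hc : ∀ i, (c i).Realizes (H i) (x i.castSucc) (x i.succ))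
    (hJ : Graph.IsSeriesJoin H x G) : Function.Injective x := by
  have key : ∀ i j : Fin (k + 1), i < j → x i ≠ x j := by
    intro i j hij hx
    obtain ⟨i', rfl⟩ : ∃ i' : Fin k, i = i'.castSucc := ⟨⟨i, by omega⟩, rfl⟩
    obtain ⟨j', rfl⟩ : ∃ j' : Fin k, j = j'.succ :=
      ⟨⟨j - 1, by omega⟩, by simp only [Fin.ext_iff, Fin.val_succ]; omega⟩
    have hi := (hc i').base
    have hj := (hc j').base
    rcases Nat.lt_or_ge i' j' with h1 | h1
    · have h2 := hJ.inter i' j' h1 _ hi.fst_mem (hx ▸ hj.snd_mem)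
      exact hj.ne (h2.2.symm.trans hx)
    · have : i' = j' := by
        rw [Fin.lt_def, Fin.val_castSucc, Fin.val_succ] at hij
        exact Fin.ext (by omega)
      subst this
      exact hi.ne hx
  intro i j h
  by_contra hne
  rcases lt_or_gt_of_ne hne with h1 | h1
  exacts [key i j h1 h, key j i h1 h.symm]

/-- The vertices and edges of a path that is given by a series node with leaves. -/
theorem exists_path_of_realizes {m : ℕ} (h : (series m fun _ => leaf).Realizes H u v) :
    ∃ (x : Fin (m + 1) → α) (e : Fin m → β), x 0 = u ∧ x (Fin.last m) = v ∧
      Function.Injective x ∧ Function.Injective e ∧ (∀ z, z ∈ V(H) ↔ ∃ i, z = x i) ∧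
      ∀ f y z, H.IsLink f y z ↔ ∃ i, f = e i ∧
        (y = x i.castSucc ∧ z = x i.succ ∨ y = x i.succ ∧ z = x i.castSucc) := by
  cases h with
  | series k hk c K x G hc hJ =>
    have hinj := injective_of_isSeriesJoin hc hJ
    choose hne e he using fun i => (hc i).eq_banana
    have hlink : ∀ f y z, H.IsLink f y z ↔ ∃ i, f = e i ∧
        (y = x i.castSucc ∧ z = x i.succ ∨ y = x i.succ ∧ z = x i.castSucc) := by
      intro f y z
      rw [hJ.union.isLink_iff]
      refine exists_congr fun i => ?_
      rw [he i]
      simp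
    refine ⟨x, e, rfl, rfl, hinj, ?_, ?_, hlink⟩
    · intro i j hij
      by_contra hne
      have h1 := hJ.union.disjoint i j hne
      rw [he i, he j] at h1
      exact Set.disjoint_left.1 h1 (show e i ∈ ({e i} : Set β) from rfl) hij
    · intro z
      rw [hJ.union.vertexSet_eq, Set.mem_iUnion]
      constructor
      · rintro ⟨i, hz⟩
        rw [he i] at hz
        rcases hz with rfl | rfl
        exacts [⟨_, rfl⟩, ⟨_, rfl⟩]
      · rintro ⟨i, rfl⟩
        rcases Nat.lt_or_ge i m with h1 | h1
        · exact ⟨⟨i, h1⟩, (hc ⟨i, h1⟩).base.fst_mem⟩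
        · refine ⟨⟨i - 1, by omega⟩, ?_⟩
          have hi : x i = x (Fin.succ ⟨i - 1, by omega⟩) :=
            congrArg x (Fin.ext (by simp only [Fin.val_succ]; omega))
          rw [hi]
          exact (hc ⟨i - 1, by omega⟩).base.snd_mem

/-- By `hout` every other edge meets the path only in an end and leads away from it. Hence there are
no chords, and inner vertices have only their two path edges. -/
theorem exists_isInducedThread {m : ℕ}
    (h : (series m fun _ => leaf).Realizes H u v)
    (hle : H ≤ G) (hout : ∀ f, f ∉ E(H) → ∀ y z, G.IsLink f y z → y ∈ V(H) →
      (y = u ∨ y = v) ∧ z ∉ V(H)) :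
    ∃ p : Fin (m + 1) → α, G.IsInducedThread m p := by
  obtain ⟨x, e, rfl, rfl, hx, he, hV, hL⟩ := exists_path_of_realizes h
  refine ⟨x, fun i => hle.vertexSet_mono ((hV _).2 ⟨i, rfl⟩), hx, fun i j => ?_,
    fun i hi hin => ?_⟩
  · constructor
    · rintro ⟨f, hf⟩
      have hfH : f ∈ E(H) := by
        by_contra hfH
        exact (hout f hfH _ _ hf ((hV _).2 ⟨i, rfl⟩)).2 ((hV _).2 ⟨j, rfl⟩)
      rw [← hle.isLink_iff hfH, hL] at hf
      obtain ⟨l, -, ⟨h1, h2⟩ | ⟨h1, h2⟩⟩ := hf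
      · rw [hx h1, hx h2]
        simp
      · rw [hx h1, hx h2]
        simp
    · rintro (hij | hij)
      · refine ⟨e ⟨i, by omega⟩, (Graph.IsLink.mono hle ((hL _ _ _).2 ⟨_, rfl, Or.inl ⟨rfl, ?_⟩⟩))⟩
        congr 1
        exact Fin.ext hij.symm
      · refine ⟨e ⟨j, by omega⟩, (Graph.IsLink.mono hle ((hL _ _ _).2 ⟨_, rfl, Or.inr ⟨?_, rfl⟩⟩))⟩
        congr 1
        exact Fin.ext hij.symm
  · have hinc : {f | G.Inc f (x i)} = {e ⟨i - 1, by omega⟩, e ⟨i, hin⟩} := by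
      ext f
      simp only [Set.mem_ofPred_eq, Set.mem_insert_iff, Set.mem_singleton_iff]
      constructor
      · rintro ⟨z, hz⟩
        have hfH : f ∈ E(H) := by
          by_contra hfH
          rcases (hout f hfH _ _ hz ((hV _).2 ⟨i, rfl⟩)).1 with h1 | h1
          · have := congrArg Fin.val (hx h1)
            rw [Fin.val_zero] at this
            omega
          · have := congrArg Fin.val (hx h1)
            rw [Fin.val_last] at this
            omega
        rw [← hle.isLink_iff hfH, hL] at hz
        obtain ⟨l, rfl, ⟨h1, -⟩ | ⟨h1, -⟩⟩ := hz
        · refine Or.inr (congrArg e (Fin.ext ?_))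
          exact (congrArg Fin.val (hx h1)).symm
        · refine Or.inl (congrArg e (Fin.ext ?_))
          have := congrArg Fin.val (hx h1)
          rw [Fin.val_succ] at this
          simp only
          omega
      · rintro (rfl | rfl)
        · refine ⟨_, Graph.IsLink.mono hle ((hL _ _ _).2 ⟨_, rfl, Or.inr ⟨?_, rfl⟩⟩)⟩
          congr 1
          refine Fin.ext ?_
          simp only [Fin.val_succ]
          omega
        · exact ⟨_, Graph.IsLink.mono hle ((hL _ _ _).2 ⟨_, rfl, Or.inl ⟨rfl, rfl⟩⟩)⟩
    rw [hinc, Set.encard_pair]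
    intro h1
    have := congrArg Fin.val (he h1)
    simp only at this
    omega

/-- In a path of length at least two, no edge joins two of the ends. -/
theorem not_isLink_ends {m : ℕ} (hm : 2 ≤ m) (h : (series m fun _ => leaf).Realizes H u v)
    {f : β} {y z : α} (hy : y = u ∨ y = v) (hz : z = u ∨ z = v) : ¬ H.IsLink f y z := by
  obtain ⟨x, e, rfl, rfl, hx, he, hV, hL⟩ := exists_path_of_realizes h
  rw [hL]
  rintro ⟨l, -, ⟨rfl, rfl⟩ | ⟨rfl, rfl⟩⟩ <;>
    rcases hy with hy | hy <;> rcases hz with hz | hz <;>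
    have h1 := congrArg Fin.val (hx hy) <;> have h2 := congrArg Fin.val (hx hz) <;>
    simp only [Fin.val_castSucc, Fin.val_succ, Fin.val_last, Fin.val_zero] at h1 h2 <;> omega

/-- A longer thread would be an induced path forbidden by `hred`. The remaining edges cannot be
chords: those of the parallel branch do not join its two terminals, and any other bead meets this
one in at most one vertex and contains no loops. -/
theorem eq_twoPath_of_isThread {k : ℕ} {c : Fin k → SPTree} {H : Fin k → Graph α β}
    {x : Fin (k + 1) → α} (hred : G.IsReduced)
    (hc : ∀ i, (c i).Realizes (H i) (x i.castSucc) (x i.succ))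
    (hJ : Graph.IsSeriesJoin H x G) {i : Fin k} {d : Fin 2 → SPTree} (hi : c i = parallel 2 d)
    (hd : ∀ j, (d j).IsThread) (j : Fin 2) : d j = twoPath := by
  have hinj := injective_of_isSeriesJoin hc hJ
  have hci := hc i
  rw [hi] at hci
  generalize hu : x i.castSucc = u at hci
  generalize hv : x i.succ = v at hci
  cases hci with
  | parallel _ _ _ K _ _ _ hK hP =>
    have hKH := fun j => edgeDisjointUnion_le hP.union j
    have hHG := fun l => edgeDisjointUnion_le hJ.union l
    obtain ⟨m, hm, hdj⟩ := hd j
    have hm2 : m = 2 := by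
      by_contra hne
      have hKj := hK j
      rw [hdj] at hKj
      suffices h : ∃ p : Fin (m + 1) → α, G.IsInducedThread m p from
        let ⟨p, hp⟩ := h
        hred ⟨m, p, by omega, hp⟩
      refine exists_isInducedThread hKj ((hKH j).trans (hHG i)) ?_
      intro f hf y z hl hy
      obtain ⟨l, hl⟩ := (hJ.union.isLink_iff f y z).1 hl
      by_cases hli : l = i
      · subst hli
        obtain ⟨j', hl⟩ := (hP.union.isLink_iff f y z).1 hl
        have hjj : j ≠ j' := by
          rintro rfl
          exact hf hl.edge_mem
        have hmem : ∀ z, z ∈ V(K j) → z ∈ V(K j') → z = u ∨ z = v := by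
          intro z h1 h2
          have : z ∈ V(K j) ∩ V(K j') := ⟨h1, h2⟩
          rwa [hP.inter j j' hjj] at this
        have hyuv := hmem y hy hl.left_mem
        refine ⟨hyuv, fun hz => ?_⟩
        obtain ⟨m', hm', hdj'⟩ := hd j'
        have hKj' := hK j'
        rw [hdj'] at hKj'
        exact not_isLink_ends hm' hKj' hyuv (hmem z hz hl.right_mem) hl
      · have hmem : ∀ z, z ∈ V(H i) → z ∈ V(H l) →
            (l < i ∧ z = u) ∨ (i < l ∧ z = v) := by
          intro z h1 h2
          rcases lt_or_gt_of_ne hli with h3 | h3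
          · exact Or.inl ⟨h3, hu ▸ (hJ.inter l i h3 z h2 h1).2⟩
          · obtain ⟨h4, h5⟩ := hJ.inter i l h3 z h1 h2
            refine Or.inr ⟨h3, ?_⟩
            rw [h5, ← hv]
            congr 1
            exact Fin.ext (by simp only [Fin.val_castSucc, Fin.val_succ]; omega)
        have h1 := hmem y ((hKH j).vertexSet_mono hy) hl.left_mem
        refine ⟨h1.imp And.right And.right, fun hz => ?_⟩
        have h2 := hmem z ((hKH j).vertexSet_mono hz) hl.right_mem
        refine (hc l).ne_of_isLink hl ?_
        rcases h1 with ⟨h3, rfl⟩ | ⟨h3, rfl⟩ <;> rcases h2 with ⟨h4, rfl⟩ | ⟨h4, rfl⟩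
        · rfl
        · exact absurd h3 h4.asymm
        · exact absurd h3 h4.asymm
        · rfl
    rw [hdj, hm2]
    rfl

theorem isP3_of_realizes (h : (series 2 fun _ => leaf).Realizes G s t) : G.IsP3 := by
  obtain ⟨x, e, -, -, hx, he, hV, hL⟩ := exists_path_of_realizes h
  refine ⟨x 0, x 1, x 2, e 0, e 1, hx.ne (by decide), hx.ne (by decide), hx.ne (by decide),
    he.ne (by decide), ?_, ?_⟩
  · ext z
    rw [hV]
    simp [Fin.exists_fin_succ]
  · intro g y z
    rw [hL]
    simp [Fin.exists_fin_two]

theorem not_isP3 {k : ℕ} (hk : 3 ≤ k) {x : Fin (k + 1) → α} (hx : Function.Injective x)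
    (hV : ∀ i, x i ∈ V(G)) : ¬ G.IsP3 := by
  classical
  rintro ⟨a, b, c, -, -, -, -, -, -, hG, -⟩
  have h1 : (Finset.univ.image x).card = k + 1 := by
    rw [Finset.card_image_of_injective _ hx, Finset.card_univ, Fintype.card_fin]
  have h2 : Finset.univ.image x ⊆ {a, b, c} := by
    intro z hz
    obtain ⟨i, -, rfl⟩ := Finset.mem_image.1 hz
    have := hV i
    rw [hG] at this
    simpa using this
  have h3 := (Finset.card_le_card h2).trans Finset.card_le_three
  omega

theorem height_R2 : R2.height = 2 := by
  simp [R2, twoPath, height, Finset.sup_const]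

/-- No vertex set disconnects a single edge, so the condition holds vacuously. The toughness is then
at least 1, which rules out a leaf as the root. -/
theorem isTough_one_of_leaf (h : SPTree.leaf.Realizes G s t) : G.IsTough 1 := by
  obtain ⟨hst, e, rfl⟩ := h.eq_banana
  intro S hS hc
  exfalso
  have hfin : V(Graph.banana s t {e}).Finite := by simp
  rw [Graph.numComponents_deleteVerts hfin] at hc
  have hl : (Graph.banana s t {e}).IsLink e s t := by simp
  have hp : (Graph.banana s t {e}).toPart = (⟨{s, t}, {e}⟩ : GraphPart α β) := rfl
  rw [hp] at hc
  have hb := fun h1 h2 => bal_leaf_none (S := (S : Set α)) hl h1 h2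
  have hb1 := fun h1 h2 => bal_leaf_one (I := Graph.banana s t {e}) (S := (S : Set α)) (e := e)
    (u := s) (v := t) h1 h2
  have hb2 := fun h1 h2 => bal_leaf_one (I := Graph.banana s t {e}) (S := (S : Set α)) (e := e)
    (u := t) (v := s) h1 h2
  have hb3 := fun h1 h2 => bal_leaf_both (I := Graph.banana s t {e}) (S := (S : Set α)) (e := e)
    (u := s) (v := t) h1 h2 hst
  rw [← leaf_comm] at hb2
  simp only [bal] at hb hb1 hb2 hb3
  by_cases h1 : s ∈ (S : Set α) <;> by_cases h2 : t ∈ (S : Set α)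
  · have h3 : ((S : Set α) ∩ {s, t}).ncard ≤ 2 := by
      rw [← Set.ncard_pair hst]
      exact Set.ncard_le_ncard Set.inter_subset_right
    have := hb3 h1 h2
    omega
  · have h3 : ((S : Set α) ∩ {s, t}).ncard ≤ 1 := by
      rw [Set.inter_insert_of_mem h1, Set.inter_singleton_eq_empty.2 h2]
      simp
    have := hb1 h1 h2
    omega
  · have h3 : ((S : Set α) ∩ {s, t}).ncard ≤ 1 := by
      rw [Set.pair_comm, Set.inter_insert_of_mem h2, Set.inter_singleton_eq_empty.2 h1]
      simp
    have := hb2 h2 h1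
    omega
  · have h3 := hb h1 h2
    rw [pair_inter_of_notMem h1 h2, Set.ncard_empty] at h3
    omega

end SPTree

/-! ### The classification -/

theorem mainTheorem6 {α : Type*} {β : Type*} (G : Graph α β) (s t : α)
    (hG : G.IsSPGraph s t) (hmin : G.IsMinimallyTough (1 / 2)) (hred : G.IsReduced) :
    (∃ T : SPTree, Graph.IsSPTreeOf T G s t) ∧
      ∀ T : SPTree, Graph.IsSPTreeOf T G s t →
        (T.height = 1 ∨ T.height = 3) ∧
        (T.height = 1 → G.IsP3) ∧
        (T.height ≠ 1 → G.IsNecklaceGraph s t ∧ ¬ G.IsP3) := by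
  obtain ⟨T₀, hT₀⟩ := hG
  refine ⟨hT₀.exists_isAlternating, ?_⟩
  rintro T ⟨hT, ha⟩
  have hbase := hT.base
  have hfin : V(G).Finite := hbase.closed.finite
  have ht := (Graph.isTough_of_toughness_eq hmin.1).tough hfin
  have hcrit : ∀ e ∈ E(G), GraphPart.Critical G G.toPart e := fun e he =>
    Graph.critical_of_not_isTough (Graph.not_isTough_of_toughness_lt (hmin.2 e he)) hfin
  have hend : ∀ u ∈ V(G), GraphPart.OneSum G G.toPart ⟨{u}, ∅⟩ u := fun u hu =>
    ⟨hbase.closed, ⟨by simp, by simp⟩, by simpa [Graph.toPart] using hu, by simp⟩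
  -- One-vertex pieces at `s` and `t` serve as the neighbours of the whole graph. Both flags of
  -- `IsBeads` are then true, so the root cannot be parallel and the end children cannot be beads.
  have hbeads := (hT.builds le_rfl).isBeads (L := ⟨{s}, ∅⟩) (R := ⟨{t}, ∅⟩) (G := G.toPart)
    ⟨hend s hbase.fst_mem, hend t hbase.snd_mem, by simpa using hbase.ne.symm, by simp⟩
    (by
      have h1 : s ∈ V(G) := hbase.fst_mem
      have h2 : t ∈ V(G) := hbase.snd_mem
      ext z
      · simp only [GraphPart.union, Graph.toPart, Set.mem_union, Set.mem_singleton_iff]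
        constructor
        · rintro (h | rfl | rfl) <;> assumption
        · exact Or.inl
      · simp [GraphPart.union, Graph.toPart]) ht hcrit
  simp only at hbeads
  have hprop := hT.isProper
  cases T with
  | leaf =>
    have h1 : G.toughness < ((1 : ℝ) : EReal) := by
      rw [hmin.1]
      exact_mod_cast (by norm_num : (1 / 2 : ℝ) < 1)
    exact absurd (SPTree.isTough_one_of_leaf hT) (Graph.not_isTough_of_toughness_lt h1)
  | parallel k c =>
    obtain ⟨a, hk, -⟩ := SPTree.parFold_toBin_eq hprop.1 c
    rw [hk] at hbeads
    exact absurd trivial hbeads.2.1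
  | series k c =>
    have hch := SPTree.children_of_isBeads hprop ha hbeads
    by_cases hall : ∀ i, c i = SPTree.leaf
    · obtain rfl : c = fun _ => SPTree.leaf := funext hall
      have hk : k = 2 := by
        by_contra hne
        obtain ⟨p, hp⟩ := SPTree.exists_isInducedThread hT le_rfl
          fun f hf y z hl => absurd hl.edge_mem hf
        exact hred ⟨k, p, by have := hprop.1; omega, hp⟩
      subst hk
      have hh : (SPTree.series 2 fun _ => SPTree.leaf).height = 1 := by simp [SPTree.height]
      exact ⟨Or.inl hh, fun _ => SPTree.isP3_of_realizes hT, fun h => absurd hh h⟩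
    · push Not at hall
      obtain ⟨i₀, hi₀⟩ := hall
      have hT' := hT
      cases hT' with
      | series _ hk _ H x _ hc hJ =>
        have hR : ∀ i, c i = SPTree.leaf ∨ (i.val ≠ 0 ∧ i.val + 1 ≠ k) ∧ c i = SPTree.R2 := by
          intro i
          refine (hch i).imp_right ?_
          rintro ⟨h1, d, hd, hth⟩
          refine ⟨h1, ?_⟩
          rw [hd, SPTree.R2]
          congr 1
          funext j
          exact SPTree.eq_twoPath_of_isThread hred hc hJ hd hth j
        have h0 := (hR i₀).resolve_left hi₀
        have hh : (SPTree.series k c).height = 3 := by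
          rw [SPTree.height]
          have h1 : (Finset.univ.sup fun i => (c i).height) = 2 := by
            refine le_antisymm (Finset.sup_le fun i _ => ?_) ?_
            · rcases hR i with h | ⟨-, h⟩
              · rw [h]
                simp [SPTree.height]
              · rw [h, SPTree.height_R2]
            · refine le_trans ?_ (Finset.le_sup (f := fun i => (c i).height) (Finset.mem_univ i₀))
              rw [h0.2, SPTree.height_R2]
          rw [h1]
        refine ⟨Or.inr hh, fun h => by omega, fun _ => ⟨⟨SPTree.series k c, ⟨hk, ?_, ?_⟩, hT⟩, ?_⟩⟩
        · exact fun i => (hR i).imp_right And.right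
        · intro i hi
          exact (hR i).resolve_right fun h => by omega
        -- The child `i₀` is neither first nor last, so `k ≥ 3` and there are at least four joining
        -- vertices.
        · refine SPTree.not_isP3 (k := k) (by omega) (SPTree.injective_of_isSeriesJoin hc hJ) ?_
          intro i
          rcases Nat.lt_or_ge i k with h1 | h1
          · exact (SPTree.edgeDisjointUnion_le hJ.union ⟨i, h1⟩).vertexSet_mono
              (hc ⟨i, h1⟩).base.fst_mem
          · have hi : i = (⟨k - 1, by omega⟩ : Fin k).succ := by
              refine Fin.ext ?_
              simp only [Fin.val_succ]
              omega
            rw [hi]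
            exact (SPTree.edgeDisjointUnion_le hJ.union _).vertexSet_mono (hc _).base.snd_mem
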